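/- Let $n\ge 1$, and let $S^n\subset\mathbb R^{n+1}$ be the unit sphere with the induced Riemannian metric $\langle\,,\rangle$, Levi-Civita connection $\nabla$ and Riemannian volume. For $p,q\in\mathbb R$ the vertical $(p,q)$-energy of a smooth vector field $\sigma$ on $S^n$ is $$E^v_{p,q}(\sigma)=\frac12\int_{S^n}\Big(\frac{1}{1+|\sigma|^2}\Big)^{p}\sum_{i}\Big(|\nabla_{E_i}\sigma|^2+q\,\langle\nabla_{E_i}\sigma,\sigma\rangle^2\Big)\,\mathrm{vol},$$ where $\{E_i\}$ is an orthonormal basis of the tangent space at each point. The field $\sigma$ is called a $(p,q)$-harmonic section of $TS^n$ if $\frac{d}{dt}\big|_{t=0}E^v_{p,q}(\sigma_t)=0$ for every smooth variation $(\sigma_t)_{t\in\mathbb R}$ of $\sigma=\sigma_0$ through vector fields. Let $a\in\mathbb R^{n+1}\setminus\{0\}$, let $\lambda\colon S^n\to\mathbb R$, $\lambda(x)=a\cdot x$, and let $\sigma=\nabla\lambda$ (the gradient of $\lambda$; such a $\sigma$ is called a conformal gradient field). Then, for all $p,q\in\mathbb R$, $\sigma$ is a $(p,q)$-harmonic section of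 $TS^n$ if and only if $$n\ge 3,\qquad p=n+1,\qquad q=2-n,\qquad \|\sigma\|_\infty=\sup_{x\in S^n}|\sigma(x)|=\frac{1}{\sqrt{n-2}}.$$ -/

import Mathlib

open scoped Manifold ContDiff Bundle

noncomputable section

namespace PQHarmonic

/-! ### Sections of Riemannian vector bundles -/

section General

variable
  {E : Type*} [NormedAddCommGroup E] [NormedSpace ℝ E] [FiniteDimensional ℝ E]
  {H : Type*} [TopologicalSpace H] {I : ModelWithCorners ℝ E H}
  {M : Type*} [TopologicalSpace M] [ChartedSpace H M]
  [Bundle.RiemannianBundle (fun x : M => TangentSpace I x)]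
  {F : Type*} [NormedAddCommGroup F] [NormedSpace ℝ F]
  {V : M → Type*} [TopologicalSpace (Bundle.TotalSpace F V)]
  [∀ x, NormedAddCommGroup (V x)] [∀ x, InnerProductSpace ℝ (V x)] [FiberBundle F V]

instance tangentFinite (x : M) : FiniteDimensional ℝ (TangentSpace I x) :=
  inferInstanceAs (FiniteDimensional ℝ E)

instance tangentComplete (x : M) : CompleteSpace (TangentSpace I x) :=
  FiniteDimensional.complete ℝ _

variable (I) in
/-- The gradient `∇f` of a function on a Riemannian manifold, determined by `g(∇f, v) = df(v)`. -/
def grad (f : M → ℝ) (x : M) : TangentSpace I x :=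
  (InnerProductSpace.toDual ℝ (TangentSpace I x)).symm (mvfderiv I f x)

/-- The restriction of the symmetric 2-tensor `h_{p,q}` on the total space of a Riemannian vector
bundle to the vertical vectors at a point `e` of a fibre `W`, vertical vectors being identified
with elements of `W`:
`w(e)^p (⟨A, B⟩ + q ⟨A, e⟩ ⟨B, e⟩)`, where `w(e) = 1 / (1 + |e|²)`. -/
def vertForm {W : Type*} [NormedAddCommGroup W] [InnerProductSpace ℝ W]
    (p q : ℝ) (e A B : W) : ℝ :=
  (1 / (1 + ‖e‖ ^ 2)) ^ p * (inner ℝ A B + q * (inner ℝ A e * inner ℝ B e))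

/-- `|d^v σ|²` at `x`, measured with `h_{p,q}`: the vertical part of `dσ(X)` is `∇_X σ`, and the
trace is taken over an orthonormal basis of `T_x M`. -/
def vertDensity (cov : CovariantDerivative I F V) (p q : ℝ) (σ : Π x : M, V x) (x : M) : ℝ :=
  ∑ i, vertForm p q (σ x)
    (cov σ x (stdOrthonormalBasis ℝ (TangentSpace I x) i))
    (cov σ x (stdOrthonormalBasis ℝ (TangentSpace I x) i))

/-- The vertical `(p,q)`-energy `½ ∫_M |d^v σ|² vol` of a section `σ`. -/
def vertEnergy [MeasurableSpace M] (vol : MeasureTheory.Measure M)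
    (cov : CovariantDerivative I F V) (p q : ℝ) (σ : Π x : M, V x) : ℝ :=
  1 / 2 * ∫ x, vertDensity cov p q σ x ∂vol

variable (I F) in
/-- `σ` is a smooth section. -/
def IsSmoothSection (σ : Π x : M, V x) : Prop :=
  ContMDiff I (I.prod 𝓘(ℝ, F)) ∞ (fun x : M => Bundle.TotalSpace.mk' F x (σ x))

variable (I F) in
/-- `s` is a smooth variation of `σ` through sections: `(x, t) ↦ s t x` is smooth on `M × ℝ`,
and `s 0 = σ`. -/
def IsSmoothVariation (σ : Π x : M, V x) (s : ℝ → Π x : M, V x) : Prop :=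
  ContMDiff (I.prod 𝓘(ℝ, ℝ)) (I.prod 𝓘(ℝ, F)) ∞
    (fun z : M × ℝ => Bundle.TotalSpace.mk' F z.1 (s z.2 z.1)) ∧ s 0 = σ

/-- A `(p,q)`-harmonic section of a Riemannian vector bundle over a compact manifold: a smooth
section which is stationary for the vertical `(p,q)`-energy with respect to all smooth variations
through sections. -/
def IsPQHarmonic [CompactSpace M] [MeasurableSpace M] (vol : MeasureTheory.Measure M)
    (cov : CovariantDerivative I F V) (p q : ℝ) (σ : Π x : M, V x) : Prop :=
  IsSmoothSection I F σ ∧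
    ∀ s : ℝ → Π x : M, V x, IsSmoothVariation I F σ s →
      HasDerivAt (fun t => vertEnergy vol cov p q (s t)) 0 0

end General

/-! ### The unit sphere in Euclidean space -/

/-- The unit sphere `S^n` in `ℝ^(n+1)`. -/
abbrev Sph (n : ℕ) : Type := Metric.sphere (0 : EuclideanSpace ℝ (Fin (n + 1))) 1

/-- The differential at `x` of the inclusion of `S^n` in `ℝ^(n+1)`. -/
def incl (n : ℕ) (x : Sph n) : TangentSpace (𝓡 n) x →L[ℝ] EuclideanSpace ℝ (Fin (n + 1)) :=
  mvfderiv (𝓡 n) (fun y : Sph n => (y : EuclideanSpace ℝ (Fin (n + 1)))) x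

theorem incl_injective (n : ℕ) (x : Sph n) : Function.Injective (incl n x) :=
  have := Fact.mk (@finrank_euclideanSpace_fin ℝ _ (n + 1))
  injective_mvfderiv_subtypeVal_sphere x

/-- The inner product on `T_x S^n` induced from `ℝ^(n+1)`. -/
def sphereInner (n : ℕ) (x : Sph n) :
    TangentSpace (𝓡 n) x →L[ℝ] TangentSpace (𝓡 n) x →L[ℝ] ℝ :=
  ContinuousLinearMap.precomp ℝ (incl n x) ∘L innerSL ℝ ∘L incl n x

theorem sphereInner_apply {n : ℕ} {x : Sph n} (u v : TangentSpace (𝓡 n) x) :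
    sphereInner n x u v = inner ℝ (incl n x u) (incl n x v) := by
  simp only [sphereInner, ContinuousLinearMap.comp_apply, ContinuousLinearMap.precomp_apply]
  rfl

/-- The Riemannian metric on `S^n` induced from `ℝ^(n+1)`. -/
def sphereMetric (n : ℕ) :
    Bundle.RiemannianMetric (fun x : Sph n => TangentSpace (𝓡 n) x) where
  inner x := sphereInner n x
  symm x v w := by rw [sphereInner_apply, sphereInner_apply, real_inner_comm]
  pos x v hv := by
    have : incl n x v ≠ 0 := fun h => hv (incl_injective n x (by rw [h, map_zero]))
    rw [sphereInner_apply]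
    exact real_inner_self_pos.2 this
  continuousAt x := by
    have h : Continuous fun v : TangentSpace (𝓡 n) x => inner ℝ (incl n x v) (incl n x v) :=
      (incl n x).continuous.inner (incl n x).continuous
    simpa only [sphereInner_apply] using h.continuousAt
  isVonNBounded x := by
    let f : EuclideanSpace ℝ (Fin n) →L[ℝ] EuclideanSpace ℝ (Fin (n + 1)) := incl n x
    obtain ⟨K, -, hK⟩ := f.toLinearMap.injective_iff_antilipschitz.1 (incl_injective n x)
    refine Bornology.IsVonNBounded.subset ?_
      (NormedSpace.isVonNBounded_closedBall ℝ (EuclideanSpace ℝ (Fin n)) (K * 1))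
    intro (v : EuclideanSpace ℝ (Fin n)) hv
    have h1 : inner ℝ (f v) (f v) < 1 := (sphereInner_apply (x := x) v v).symm.trans_lt hv
    rw [real_inner_self_eq_norm_sq] at h1
    have h2 : ‖f v‖ ≤ 1 := by nlinarith [norm_nonneg (f v)]
    have h3 : dist v 0 ≤ K * dist (f v) (f 0) := hK.le_mul_dist v 0
    rw [map_zero, dist_zero_right (f v)] at h3
    exact (Metric.mem_closedBall (α := EuclideanSpace ℝ (Fin n))).2 (h3.trans (mul_le_mul_of_nonneg_left h2 K.2))

instance sphereRiemannian (n : ℕ) :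
    Bundle.RiemannianBundle (fun x : Sph n => TangentSpace (𝓡 n) x) := ⟨sphereMetric n⟩

/-- Orthogonal projection `ℝ^(n+1) → T_x S^n`. -/
def proj (n : ℕ) (x : Sph n) : EuclideanSpace ℝ (Fin (n + 1)) →L[ℝ] TangentSpace (𝓡 n) x :=
  (incl n x).adjoint

theorem inner_tangent {n : ℕ} {x : Sph n} (u v : TangentSpace (𝓡 n) x) :
    inner ℝ u v = inner ℝ (incl n x u) (incl n x v) := sphereInner_apply u v

theorem proj_incl {n : ℕ} {x : Sph n} (u : TangentSpace (𝓡 n) x) :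
    proj n x (incl n x u) = u := by
  refine ext_inner_right ℝ fun v => ?_
  rw [proj, ContinuousLinearMap.adjoint_inner_left, inner_tangent]

theorem mdifferentiableAt_incl {n : ℕ} {σ : Π x : Sph n, TangentSpace (𝓡 n) x} {x : Sph n}
    (hσ : MDifferentiableAt (𝓡 n) ((𝓡 n).prod 𝓘(ℝ, EuclideanSpace ℝ (Fin n)))
      (fun y => Bundle.TotalSpace.mk' (EuclideanSpace ℝ (Fin n)) y (σ y)) x) :
    MDifferentiableAt (𝓡 n) 𝓘(ℝ, EuclideanSpace ℝ (Fin (n + 1))) (fun y => incl n y (σ y)) x := by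
  have := Fact.mk (@finrank_euclideanSpace_fin ℝ _ (n + 1))
  have hc : ContMDiff (𝓡 n) 𝓘(ℝ, EuclideanSpace ℝ (Fin (n + 1))) ω
      (fun y : Sph n => (y : EuclideanSpace ℝ (Fin (n + 1)))) := contMDiff_coe_sphere
  have h1 := (hc.contMDiff_tangentMap (m := 1) le_top).mdifferentiableAt (x :=
    Bundle.TotalSpace.mk' (EuclideanSpace ℝ (Fin n)) x (σ x)) one_ne_zero
  have h2 := (contMDiff_snd_tangentBundle_modelSpace (EuclideanSpace ℝ (Fin (n + 1)))
    𝓘(ℝ, EuclideanSpace ℝ (Fin (n + 1))) (n := 1)).mdifferentiableAt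
      (x := tangentMap (𝓡 n) 𝓘(ℝ, EuclideanSpace ℝ (Fin (n + 1)))
    (fun y : Sph n => (y : EuclideanSpace ℝ (Fin (n + 1))))
      (Bundle.TotalSpace.mk' (EuclideanSpace ℝ (Fin n)) x (σ x))) one_ne_zero
  exact (h2.comp x (h1.comp x hσ) :)

/-- The Levi-Civita connection of `S^n`: the tangential part of the ambient derivative. -/
def leviCivita (n : ℕ) :
    CovariantDerivative (𝓡 n) (EuclideanSpace ℝ (Fin n))
      (fun x : Sph n => TangentSpace (𝓡 n) x) where
  toFun σ x := proj n x ∘L mvfderiv (𝓡 n) (fun y : Sph n => incl n y (σ y)) x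
  isCovariantDerivativeOnUniv :=
    { add := by
        intro σ τ x hσ hτ _
        have h := mvfderiv_add (mdifferentiableAt_incl hσ) (mdifferentiableAt_incl hτ)
        have e : (fun y : Sph n => incl n y ((σ + τ) y)) =
            (fun y => incl n y (σ y)) + fun y => incl n y (τ y) := by
          ext1 y; exact map_add _ _ _
        rw [e, h, ContinuousLinearMap.comp_add]
      leibniz := by
        intro σ g x hσ hg _
        have h := mvfderiv_smul hg (mdifferentiableAt_incl hσ)
        have e : (fun y : Sph n => incl n y ((g • σ) y)) =
            g • fun y => incl n y (σ y) := by
          ext1 y; exact map_smul (incl n y) _ _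
        rw [e, h]
        ext1 v
        simp [proj_incl] }

/-- The Riemannian volume measure of `S^n`. -/
def sphereVol (n : ℕ) : MeasureTheory.Measure (Sph n) :=
  (MeasureTheory.volume : MeasureTheory.Measure (EuclideanSpace ℝ (Fin (n + 1)))).toSphere

/-- The conformal gradient field on `S^n` with axial vector `a`: the gradient of the restriction
to `S^n` of the linear functional dual to `a`. -/
def conformalGradientField (n : ℕ) (a : EuclideanSpace ℝ (Fin (n + 1))) (x : Sph n) :
    TangentSpace (𝓡 n) x :=
  grad (𝓡 n) (fun y : Sph n => (inner ℝ a (y : EuclideanSpace ℝ (Fin (n + 1))) : ℝ)) x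

end PQHarmonic

end

open scoped Manifold ContDiff Bundle

noncomputable section

namespace PQHarmonic

open MeasureTheory Set

/-! A tangent field `σ` on the sphere is treated as an `ℝ^(n+1)`-valued map, extended to be constant
along rays (`ambient`). Covariant derivatives and traces then become ordinary derivatives and traces
in Euclidean space (`vertDensity_eq`), and the energy can be differentiated under the integral
(`hasDerivAt_vertEnergy`).

For the conformal field, `σ = a - λx` and `∇_X σ = -λX`. With `w = 1/(1+|σ|²)` and a variation field
`ψ`, the derivatives of `ψ` in the first variation form the divergence of `w^p λ (ψ + q⟨ψ,σ⟩σ)`, up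
to sign and terms without derivatives of `ψ`. By `integral_toSphere_div` this integrates to zero,
and what remains is `∫ w^(p+1) C ⟨σ,ψ⟩`, where `C` is the polynomial `eulerLagrangePoly` in `r =
|σ|²` and `l = λ²`, and `r + l = |a|²`.

Testing with `ψ = Cσ` gives `∫ w^(p+1) C² r = 0`, so harmonicity forces `C = 0` wherever `σ ≠ 0`;
conversely `C = 0` everywhere suffices. Since `λ/|a|` takes every value in `[-1,1]`, the question is
when `C` vanishes identically on the segment `r + l = |a|²`. Three sample points give `q|a|² = -1`,
`p = n+1` and `|a|²(n-2) = 1` (`parameters_of_eulerLagrangePoly_eq_zero`). Positivity of `|a|²` then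
rules out `n ≤ 2`, and `|a|` is the maximum of `|σ|`, attained on the equator orthogonal to `a`. -/

instance factFinrankAmbient (n : ℕ) :
    Fact (Module.finrank ℝ (EuclideanSpace ℝ (Fin (n + 1))) = n + 1) :=
  ⟨finrank_euclideanSpace_fin⟩

/-! ### Radial projection and the tangent spaces inside the ambient space. -/

/-- The radial projection of `ℝ^(n+1)` on the unit sphere (the value at `0` is irrelevant). -/
def radial (n : ℕ) (x : EuclideanSpace ℝ (Fin (n + 1))) : Sph n :=
  if h : x = 0 then ⟨EuclideanSpace.single 0 1, by simp⟩
  else ⟨‖x‖⁻¹ • x, by simp [norm_smul, h]⟩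

theorem coe_radial {n : ℕ} {x : EuclideanSpace ℝ (Fin (n + 1))} (hx : x ≠ 0) :
    (radial n x : EuclideanSpace ℝ (Fin (n + 1))) = ‖x‖⁻¹ • x := by
  simp [radial, hx]

theorem sph_norm {n : ℕ} (x : Sph n) : ‖(x : EuclideanSpace ℝ (Fin (n + 1)))‖ = 1 := by
  simp

theorem sph_ne_zero {n : ℕ} (x : Sph n) : (x : EuclideanSpace ℝ (Fin (n + 1))) ≠ 0 :=
  ne_zero_of_mem_unit_sphere x

theorem radial_coe {n : ℕ} (x : Sph n) : radial n x = x := by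
  apply Subtype.ext
  rw [coe_radial (sph_ne_zero x)]
  simp

theorem radial_smul {n : ℕ} {x : EuclideanSpace ℝ (Fin (n + 1))} (hx : x ≠ 0) {r : ℝ}
    (hr : 0 < r) : radial n (r • x) = radial n x := by
  apply Subtype.ext
  rw [coe_radial hx, coe_radial (smul_ne_zero hr.ne' hx), norm_smul, smul_smul,
    Real.norm_of_nonneg hr.le]
  congr 1
  field_simp

theorem contMDiffAt_radial {n : ℕ} {x : EuclideanSpace ℝ (Fin (n + 1))} (hx : x ≠ 0)
    {m : ℕ∞ω} : ContMDiffAt 𝓘(ℝ, EuclideanSpace ℝ (Fin (n + 1))) (𝓡 n) m (radial n) x := by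
  -- `codRestrict_sphere` is applied to a globally smooth map, so the punctured space is taken as a
  -- manifold in its own right.
  let U : TopologicalSpace.Opens (EuclideanSpace ℝ (Fin (n + 1))) := ⟨{0}ᶜ, isOpen_compl_singleton⟩
  have h1 : ContMDiff 𝓘(ℝ, EuclideanSpace ℝ (Fin (n + 1)))
      𝓘(ℝ, EuclideanSpace ℝ (Fin (n + 1))) m
      (fun y : U => ‖(y : EuclideanSpace ℝ (Fin (n + 1)))‖⁻¹ •
        (y : EuclideanSpace ℝ (Fin (n + 1)))) := by
    intro y
    have hy : (y : EuclideanSpace ℝ (Fin (n + 1))) ≠ 0 := y.2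
    refine (contMDiffAt_subtype_iff (U := U)
      (f := fun y : EuclideanSpace ℝ (Fin (n + 1)) => ‖y‖⁻¹ • y)).2 ?_
    exact (((contDiffAt_norm ℝ hy).inv (norm_ne_zero_iff.2 hy)).smul contDiffAt_id).contMDiffAt
  have h2 := h1.codRestrict_sphere (n := n) (fun y => by
    have hy : (y : EuclideanSpace ℝ (Fin (n + 1))) ≠ 0 := y.2
    simp [norm_smul, hy])
  refine (contMDiffAt_subtype_iff (U := U) (f := radial n) (x := ⟨x, hx⟩)).1 ?_
  convert! h2 ⟨x, hx⟩ using 1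
  ext1 y
  exact Subtype.ext (coe_radial y.2)

/-- Chain rule for `f = (f ∘ radial) ∘ coe`: intrinsic differentials on the sphere become Fréchet
derivatives of the extension along rays. -/
theorem mvfderiv_eq_fderiv {n : ℕ} {F : Type*} [NormedAddCommGroup F] [NormedSpace ℝ F]
    {f : Sph n → F} {x : Sph n} (hf : MDifferentiableAt (𝓡 n) 𝓘(ℝ, F) f x) :
    mvfderiv (𝓡 n) f x = (fderiv ℝ (fun y => f (radial n y)) x) ∘L incl n x := by
  have hr : MDifferentiableAt 𝓘(ℝ, EuclideanSpace ℝ (Fin (n + 1))) (𝓡 n) (radial n) x :=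
    (contMDiffAt_radial (m := 1) (sph_ne_zero x)).mdifferentiableAt one_ne_zero
  have hg : MDifferentiableAt 𝓘(ℝ, EuclideanSpace ℝ (Fin (n + 1))) 𝓘(ℝ, F)
      (fun y => f (radial n y)) x := by
    refine MDifferentiableAt.comp (x : EuclideanSpace ℝ (Fin (n + 1))) (g := f) ?_ hr
    rwa [radial_coe]
  have hc : MDifferentiableAt (𝓡 n) 𝓘(ℝ, EuclideanSpace ℝ (Fin (n + 1)))
      (fun y : Sph n => (y : EuclideanSpace ℝ (Fin (n + 1)))) x :=
    (contMDiff_coe_sphere (m := 1)).mdifferentiableAt one_ne_zero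
  have e : (fun y => f (radial n y)) ∘
      (fun y : Sph n => (y : EuclideanSpace ℝ (Fin (n + 1)))) = f := by
    ext1 y; simp [radial_coe]
  have h := mfderiv_comp x hg hc
  rw [e, mfderiv_eq_fderiv] at h
  unfold mvfderiv incl
  rw [h]
  rfl

theorem inner_incl {n : ℕ} (x : Sph n) (u : TangentSpace (𝓡 n) x) :
    inner ℝ (x : EuclideanSpace ℝ (Fin (n + 1))) (incl n x u) = 0 := by
  have h : incl n x u ∈ (ℝ ∙ (x : EuclideanSpace ℝ (Fin (n + 1))))ᗮ := by
    rw [← range_mvfderiv_subtypeVal (n := n) x]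
    exact ⟨u, rfl⟩
  exact Submodule.mem_orthogonal_singleton_iff_inner_right.1 h

theorem incl_proj {n : ℕ} (x : Sph n) (w : EuclideanSpace ℝ (Fin (n + 1))) :
    incl n x (proj n x w) = w - inner ℝ (x : EuclideanSpace ℝ (Fin (n + 1))) w • (x : EuclideanSpace ℝ (Fin (n + 1))) := by
  have h : w - inner ℝ (x : EuclideanSpace ℝ (Fin (n + 1))) w • (x : EuclideanSpace ℝ (Fin (n + 1)))
      ∈ (ℝ ∙ (x : EuclideanSpace ℝ (Fin (n + 1))))ᗮ := by
    rw [Submodule.mem_orthogonal_singleton_iff_inner_right, inner_sub_right, inner_smul_right,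
      real_inner_self_eq_norm_sq, sph_norm]
    ring
  rw [← range_mvfderiv_subtypeVal (n := n) x] at h
  obtain ⟨u, hu⟩ := h
  have hu' : incl n x u = w - inner ℝ (x : EuclideanSpace ℝ (Fin (n + 1))) w • (x : EuclideanSpace ℝ (Fin (n + 1))) := hu
  rw [← hu']
  congr 1
  refine ext_inner_right ℝ fun v => ?_
  rw [proj, ContinuousLinearMap.adjoint_inner_left, inner_tangent, hu', inner_sub_left,
    inner_smul_left, inner_incl]
  simp

theorem norm_incl {n : ℕ} (x : Sph n) (u : TangentSpace (𝓡 n) x) : ‖incl n x u‖ = ‖u‖ := by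
  rw [norm_eq_sqrt_real_inner, norm_eq_sqrt_real_inner (F := TangentSpace (𝓡 n) x), inner_tangent]

/-- Traces over `T_x S^n` of operators which kill the normal vector `x` are ambient traces. -/
theorem sum_inner_incl {n : ℕ} (x : Sph n)
    (T : EuclideanSpace ℝ (Fin (n + 1)) →L[ℝ] EuclideanSpace ℝ (Fin (n + 1)))
    (hT : T x = 0) {ι : Type*} [Fintype ι] (e : OrthonormalBasis ι ℝ (TangentSpace (𝓡 n) x))
    {κ : Type*} [Fintype κ] (b : OrthonormalBasis κ ℝ (EuclideanSpace ℝ (Fin (n + 1)))) :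
    ∑ i, inner ℝ (incl n x (e i)) (T (incl n x (e i))) = ∑ j, inner ℝ (b j) (T (b j)) := by
  classical
  have h1 : ∑ i, inner ℝ (incl n x (e i)) (T (incl n x (e i))) =
      LinearMap.trace ℝ _ ((proj n x ∘L T : EuclideanSpace ℝ (Fin (n + 1)) →L[ℝ]
        TangentSpace (𝓡 n) x).toLinearMap ∘ₗ (incl n x).toLinearMap) := by
    rw [LinearMap.trace_eq_sum_inner _ e]
    refine Finset.sum_congr rfl fun i _ => ?_
    simp only [LinearMap.comp_apply, ContinuousLinearMap.coe_coe, ContinuousLinearMap.comp_apply]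
    rw [proj, ContinuousLinearMap.adjoint_inner_right]
  -- Cyclicity moves the trace to the ambient space, where `incl ∘ proj` is the identity minus the
  -- projection on `x`. The correction term is `⟨x, T x⟩`, which vanishes.
  rw [h1, LinearMap.trace_comp_comm', LinearMap.trace_eq_sum_inner _ b]
  have h2 : ((incl n x).toLinearMap ∘ₗ (proj n x ∘L T : EuclideanSpace ℝ (Fin (n + 1)) →L[ℝ]
        TangentSpace (𝓡 n) x).toLinearMap) = T.toLinearMap -
        ((innerSL ℝ (x : EuclideanSpace ℝ (Fin (n + 1))) ∘L T).smulRight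
          (x : EuclideanSpace ℝ (Fin (n + 1)))).toLinearMap := by
    ext1 w
    simp [incl_proj]
  simp only [h2, LinearMap.sub_apply, inner_sub_right, Finset.sum_sub_distrib]
  refine sub_eq_self.2 ?_
  have h3 := b.sum_inner_mul_inner (T.adjoint (x : EuclideanSpace ℝ (Fin (n + 1)))) (x : EuclideanSpace ℝ (Fin (n + 1)))
  rw [ContinuousLinearMap.adjoint_inner_left, hT, inner_zero_right] at h3
  rw [← h3]
  refine Finset.sum_congr rfl fun j _ => ?_
  simp [inner_smul_right, ContinuousLinearMap.adjoint_inner_left]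

/-! ### The divergence theorem on the unit sphere. -/

section Divergence

variable {E : Type*} [NormedAddCommGroup E] [InnerProductSpace ℝ E] [FiniteDimensional ℝ E]
  [MeasurableSpace E] [BorelSpace E] (μ : Measure E) [μ.IsAddHaarMeasure]

theorem integral_polar [Nontrivial E] (F : E → ℝ) (k : ℝ → ℝ) :
    ∫ x, k ‖x‖ * F (‖x‖⁻¹ • x) ∂μ = (∫ x : Metric.sphere (0 : E) 1, F x ∂μ.toSphere) *
      ∫ r : Ioi (0 : ℝ), k r ∂(Measure.volumeIoiPow (Module.finrank ℝ E - 1)) := by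
  calc
    ∫ x, k ‖x‖ * F (‖x‖⁻¹ • x) ∂μ =
        ∫ x : ({(0)}ᶜ : Set E), k ‖x.1‖ * F (‖x.1‖⁻¹ • x.1) ∂(μ.comap (↑)) := by
      rw [integral_subtype_comap (measurableSet_singleton _).compl
        fun x => k ‖x‖ * F (‖x‖⁻¹ • x), restrict_compl_singleton]
    _ = ∫ z : Metric.sphere (0 : E) 1 × Ioi (0 : ℝ), F z.1 * k z.2
          ∂(μ.toSphere.prod (.volumeIoiPow (Module.finrank ℝ E - 1))) := by
      rw [← μ.measurePreserving_homeomorphUnitSphereProd.integral_comp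
        (Homeomorph.measurableEmbedding _)]
      refine integral_congr_ae (.of_forall fun x => ?_)
      simp [mul_comm]
    _ = _ := integral_prod_mul (fun x : Metric.sphere (0 : E) 1 => F x)
        (fun r : Ioi (0 : ℝ) => k r)

theorem integral_fderiv_eq_zero {g : E → ℝ} (hg : ContDiff ℝ 1 g) (hc : HasCompactSupport g)
    (v : E) : ∫ x, fderiv ℝ g x v ∂μ = 0 := by
  have hd : Continuous fun x => fderiv ℝ g x v := (hg.continuous_fderiv one_ne_zero).clm_apply
    continuous_const
  -- Integration by parts against the constant `1`; integrability is asked only of the products, so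
  -- `1` itself need not be integrable.
  have h := integral_mul_fderiv_eq_neg_fderiv_mul_of_integrable (μ := μ) (𝕜 := ℝ)
    (f := fun _ : E => (1 : ℝ)) (g := g) (v := v) (by simp)
    (by simpa using hd.integrable_of_hasCompactSupport (hc.fderiv_apply ℝ v))
    (by simpa using hg.continuous.integrable_of_hasCompactSupport hc)
    (by fun_prop) (fun x _ => hg.differentiable one_ne_zero x)
  simpa using h

/-- The divergence theorem on the unit sphere, for a tangential field extended to be constant
along rays. -/
theorem integral_toSphere_div [Nontrivial E] {Y : E → E} (hY : ContDiffOn ℝ 1 Y {0}ᶜ)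
    (hray : ∀ x ≠ 0, ∀ r > (0 : ℝ), Y (r • x) = Y x) (htan : ∀ x ≠ 0, inner ℝ (Y x) x = 0)
    {ι : Type*} [Fintype ι] (b : OrthonormalBasis ι ℝ E) :
    ∫ x : Metric.sphere (0 : E) 1, ∑ j, inner ℝ (fderiv ℝ Y x (b j)) (b j) ∂μ.toSphere = 0 := by
  -- The radial cutoff lives on the shell `1 ≤ |x| ≤ 3`, away from the origin, where neither `Y` nor
  -- the norm is smooth.
  let φ : ContDiffBump (2 : ℝ) := ⟨1 / 2, 1, by norm_num, by norm_num⟩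
  let h : E → ℝ := fun x => φ ‖x‖
  have hφ0 : ∀ r : ℝ, r ≤ 1 → φ r = 0 := fun r hr => by
    refine φ.zero_of_le_dist ?_
    rw [Real.dist_eq, abs_sub_comm, abs_of_nonneg (by linarith)]
    change (1 : ℝ) ≤ _
    linarith
  have hφ3 : ∀ r : ℝ, 3 ≤ r → φ r = 0 := fun r hr => by
    refine φ.zero_of_le_dist ?_
    rw [Real.dist_eq, abs_of_nonneg (by linarith)]
    change (1 : ℝ) ≤ _
    linarith
  have hYd : ∀ x ≠ 0, ContDiffAt ℝ 1 Y x := fun x hx =>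
    (hY x hx).contDiffAt (isOpen_compl_singleton.mem_nhds hx)
  have near0 : ∀ᶠ x : E in nhds 0, h x = 0 := by
    filter_upwards [Metric.ball_mem_nhds (0 : E) one_pos] with x hx
    exact hφ0 _ (by simpa using (mem_ball_zero_iff.1 hx).le)
  have hh : ∀ x ≠ 0, ContDiffAt ℝ 1 h x := fun x hx =>
    φ.contDiff.contDiffAt.comp x (contDiffAt_norm ℝ hx)
  have hg : ∀ j, ContDiff ℝ 1 fun x => h x * inner ℝ (Y x) (b j) := fun j => by
    rw [contDiff_iff_contDiffAt]
    intro x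
    by_cases hx : x = 0
    · subst hx
      refine (contDiffAt_const (c := (0 : ℝ))).congr_of_eventuallyEq ?_
      filter_upwards [near0] with x hx
      simp [hx]
    · exact (hh x hx).mul ((hYd x hx).inner ℝ contDiffAt_const)
  have hcs : ∀ j, HasCompactSupport fun x => h x * inner ℝ (Y x) (b j) := fun j => by
    refine HasCompactSupport.intro (isCompact_closedBall (0 : E) 3) fun x hx => ?_
    have : 3 ≤ ‖x‖ := by
      by_contra hlt
      exact hx (by simpa using (not_le.1 hlt).le)
    simp [h, hφ3 _ this]
  have hsum : ∫ x, ∑ j, fderiv ℝ (fun x => h x * inner ℝ (Y x) (b j)) x (b j) ∂μ = 0 := by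
    rw [integral_finsetSum]
    · exact Finset.sum_eq_zero fun j _ => integral_fderiv_eq_zero μ (hg j) (hcs j) _
    · intro j _
      exact (((hg j).continuous_fderiv one_ne_zero).clm_apply
        continuous_const).integrable_of_hasCompactSupport ((hcs j).fderiv_apply ℝ _)
  have hscale : ∀ x : E, x ≠ 0 → ∀ v, fderiv ℝ Y x v = ‖x‖⁻¹ • fderiv ℝ Y (‖x‖⁻¹ • x) v := by
    intro x hx v
    have hr : (0 : ℝ) < ‖x‖⁻¹ := inv_pos.2 (norm_pos_iff.2 hx)
    have e : Y =ᶠ[nhds x] fun y => Y (‖x‖⁻¹ • y) := by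
      filter_upwards [isOpen_compl_singleton.mem_nhds hx] with y hy
      exact (hray y hy _ hr).symm
    rw [e.fderiv_eq, fderiv_comp_smul]
    rfl
  -- `div (hY) = h div Y + ⟨∇h, Y⟩`. The last term vanishes because `h` is radial and `Y` is
  -- tangential, and `div Y` is homogeneous of degree `-1`; the integrand thus separates in polar
  -- coordinates.
  have hpt : ∀ x : E, ∑ j, fderiv ℝ (fun x => h x * inner ℝ (Y x) (b j)) x (b j) =
      (φ ‖x‖ * ‖x‖⁻¹) * ∑ j, inner ℝ (fderiv ℝ Y (‖x‖⁻¹ • x) (b j)) (b j) := by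
    intro x
    by_cases hx : x = 0
    · subst hx
      have : ∀ j, fderiv ℝ (fun x => h x * inner ℝ (Y x) (b j)) 0 = 0 := fun j => by
        have e : (fun x => h x * inner ℝ (Y x) (b j)) =ᶠ[nhds 0] fun _ => (0 : ℝ) := by
          filter_upwards [near0] with x hx
          simp [hx]
        rw [e.fderiv_eq]; simp
      simp [this]
    · have hd : DifferentiableAt ℝ h x := (hh x hx).differentiableAt one_ne_zero
      have hYx : DifferentiableAt ℝ Y x := (hYd x hx).differentiableAt one_ne_zero
      have hdi : ∀ j, fderiv ℝ (fun x => h x * inner ℝ (Y x) (b j)) x (b j) =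
          h x * inner ℝ (fderiv ℝ Y x (b j)) (b j) +
            inner ℝ (Y x) (b j) * fderiv ℝ h x (b j) := fun j => by
        rw [fderiv_fun_mul hd (hYx.inner ℝ (differentiableAt_const _))]
        simp [fderiv_inner_apply ℝ hYx (differentiableAt_const (b j))]
      have hgrad : fderiv ℝ h x (Y x) = 0 := by
        have h1 : fderiv ℝ h x = deriv φ ‖x‖ • fderiv ℝ (fun y : E => ‖y‖) x := by
          have hA : HasDerivAt φ (deriv φ ‖x‖) ‖x‖ :=
            ((φ.contDiff (n := 1)).differentiable one_ne_zero _).hasDerivAt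
          have hB : HasFDerivAt (fun y : E => ‖y‖) (fderiv ℝ (fun y : E => ‖y‖) x) x :=
            ((contDiffAt_norm ℝ hx (n := 1)).differentiableAt one_ne_zero).hasFDerivAt
          exact (hA.comp_hasFDerivAt x hB).fderiv
        have h2 : fderiv ℝ (fun y : E => ‖y‖) x (Y x) = 0 := by
          have h3 : HasFDerivAt (fun y : E => ‖y‖) (fderiv ℝ (fun y : E => ‖y‖) x) x :=
            ((contDiffAt_norm ℝ hx (n := 1)).differentiableAt one_ne_zero).hasFDerivAt
          have h4 := (h3.pow 2).unique (HasStrictFDerivAt.hasFDerivAt (hasStrictFDerivAt_norm_sq x))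
          have h5 := DFunLike.congr_fun h4 (Y x)
          have h6 : inner ℝ x (Y x) = 0 := by rw [real_inner_comm, htan x hx]
          simpa [h6, hx] using h5
        simp [h1, h2]
      simp only [hdi, Finset.sum_add_distrib]
      have h6 : ∑ j, inner ℝ (Y x) (b j) * fderiv ℝ h x (b j) = fderiv ℝ h x (Y x) := by
        conv_rhs => rw [← b.sum_repr' (Y x), map_sum]
        refine Finset.sum_congr rfl fun j _ => ?_
        rw [map_smul, smul_eq_mul, real_inner_comm]
      rw [h6, hgrad, add_zero, Finset.mul_sum]
      refine Finset.sum_congr rfl fun j _ => ?_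
      rw [hscale x hx, inner_smul_left]
      simp [h, mul_assoc]
  simp_rw [hpt] at hsum
  rw [integral_polar μ (fun x => ∑ j, inner ℝ (fderiv ℝ Y x (b j)) (b j))
    (fun r => φ r * r⁻¹)] at hsum
  refine (mul_eq_zero.1 hsum).resolve_right fun h0 => ?_
  -- The radial factor is nonzero: otherwise the polar formula with angular part `1` would give zero
  -- integral to a continuous nonnegative function that is positive on `|x| = 2`.
  have h7 := integral_polar μ (fun _ => (1 : ℝ)) (fun r => φ r * r⁻¹)
  rw [h0, mul_zero] at h7
  simp only [mul_one] at h7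
  have hcont : Continuous fun x : E => φ ‖x‖ * ‖x‖⁻¹ := by
    rw [continuous_iff_continuousAt]
    intro x
    by_cases hx : x = 0
    · subst hx
      refine (continuousAt_const (y := (0 : ℝ))).congr ?_
      filter_upwards [near0] with x hx
      simp [h] at hx
      simp [hx]
    · exact (hh x hx).continuousAt.mul (continuousAt_id.norm.inv₀ (norm_ne_zero_iff.2 hx))
  have hcs' : HasCompactSupport fun x : E => φ ‖x‖ * ‖x‖⁻¹ := by
    refine HasCompactSupport.intro (isCompact_closedBall (0 : E) 3) fun x hx => ?_
    have : 3 ≤ ‖x‖ := by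
      by_contra hlt
      exact hx (by simpa using (not_le.1 hlt).le)
    simp [hφ3 _ this]
  obtain ⟨x, hx⟩ := exists_norm_eq E (zero_le_two (α := ℝ))
  refine (hcont.integral_pos_of_hasCompactSupport_nonneg_nonzero hcs'
    (fun y => mul_nonneg φ.nonneg (inv_nonneg.2 (norm_nonneg y))) (x := x) ?_).ne' h7
  rw [hx, φ.one_of_mem_closedBall (Metric.mem_closedBall_self (by norm_num))]
  norm_num

end Divergence

/-! ### Smooth maps into the tangent bundle of the sphere. -/

section Sections

variable {E' : Type*} [NormedAddCommGroup E'] [NormedSpace ℝ E'] {H' : Type*} [TopologicalSpace H']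
  {I' : ModelWithCorners ℝ E' H'} {M' : Type*} [TopologicalSpace M'] [ChartedSpace H' M']

/-- A smooth lift of a map to the tangent bundle of the sphere is smooth as a map to the ambient
space. -/
theorem contMDiff_incl {n : ℕ} {f : M' → Sph n} {σ : Π z : M', TangentSpace (𝓡 n) (f z)}
    (h : ContMDiff I' ((𝓡 n).prod 𝓘(ℝ, EuclideanSpace ℝ (Fin n))) ∞
      (fun z => (Bundle.TotalSpace.mk' (EuclideanSpace ℝ (Fin n)) (f z) (σ z) :
        TangentBundle (𝓡 n) (Sph n)))) :
    ContMDiff I' 𝓘(ℝ, EuclideanSpace ℝ (Fin (n + 1))) ∞ (fun z => incl n (f z) (σ z)) := by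
  have hc : ContMDiff (𝓡 n) 𝓘(ℝ, EuclideanSpace ℝ (Fin (n + 1))) ω
      (fun y : Sph n => (y : EuclideanSpace ℝ (Fin (n + 1)))) := contMDiff_coe_sphere
  have h1 := hc.contMDiff_tangentMap (m := ∞) le_top
  have h2 := contMDiff_snd_tangentBundle_modelSpace (EuclideanSpace ℝ (Fin (n + 1)))
    𝓘(ℝ, EuclideanSpace ℝ (Fin (n + 1))) (n := ∞)
  exact (h2.comp (h1.comp h) :)

theorem norm_add_smul_ne_zero {n : ℕ} (x : Sph n) {w : EuclideanSpace ℝ (Fin (n + 1))}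
    (hw : inner ℝ (x : EuclideanSpace ℝ (Fin (n + 1))) w = 0) (τ : ℝ) :
    ‖(x : EuclideanSpace ℝ (Fin (n + 1))) + τ • w‖ ≠ 0 := by
  intro h
  have h1 : inner ℝ (x : EuclideanSpace ℝ (Fin (n + 1)))
      ((x : EuclideanSpace ℝ (Fin (n + 1))) + τ • w) = 1 := by
    rw [inner_add_right, inner_smul_right, hw, real_inner_self_eq_norm_sq, sph_norm]
    norm_num
  rw [norm_eq_zero.1 h, inner_zero_right] at h1
  exact zero_ne_one h1

/-- To first order the norm does not change in a direction orthogonal to `x`. The normalized line is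
therefore a curve on the sphere with velocity `w`. -/
theorem hasDerivAt_normalize {n : ℕ} (x : Sph n) {w : EuclideanSpace ℝ (Fin (n + 1))}
    (hw : inner ℝ (x : EuclideanSpace ℝ (Fin (n + 1))) w = 0) :
    HasDerivAt (fun τ : ℝ => ‖(x : EuclideanSpace ℝ (Fin (n + 1))) + τ • w‖⁻¹ •
      ((x : EuclideanSpace ℝ (Fin (n + 1))) + τ • w)) w 0 := by
  have h1 : HasDerivAt (fun τ : ℝ => (x : EuclideanSpace ℝ (Fin (n + 1))) + τ • w) w 0 := by
    simpa using ((hasDerivAt_id (0 : ℝ)).smul_const w).const_add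
      (x : EuclideanSpace ℝ (Fin (n + 1)))
  have h2 : HasDerivAt (fun τ : ℝ => ‖(x : EuclideanSpace ℝ (Fin (n + 1))) + τ • w‖⁻¹) 0 0 := by
    have h3 := h1.norm_sq
    have h4 : HasDerivAt (fun τ : ℝ => √(‖(x : EuclideanSpace ℝ (Fin (n + 1))) + τ • w‖ ^ 2)) 0 0 := by
      have := h3.sqrt (by simp)
      simpa [hw] using this
    simp only [Real.sqrt_sq (norm_nonneg _)] at h4
    simpa using h4.fun_inv (by simp)
  have h5 := h2.fun_smul h1
  simp only [zero_smul, add_zero, sph_norm, inv_one, one_smul] at h5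
  exact h5

/-- The base points are only propositionally equal; comparing fibre vectors through their ambient
images avoids transport between tangent spaces. -/
theorem mk_eq_mk_proj {n : ℕ} {x y : Sph n} (h : x = y) {u : TangentSpace (𝓡 n) x}
    {w : EuclideanSpace ℝ (Fin (n + 1))} (hu : incl n x u = w) :
    (Bundle.TotalSpace.mk' (EuclideanSpace ℝ (Fin n)) x u : TangentBundle (𝓡 n) (Sph n)) =
      Bundle.TotalSpace.mk' (EuclideanSpace ℝ (Fin n)) y (proj n y w) := by
  subst h hu
  rw [proj_incl]

theorem incl_mfderiv_eq_deriv {n : ℕ} [IsManifold I' 1 M'] {Ψ : M' × ℝ → Sph n} {z : M'}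
    (hΨ : MDifferentiableAt (I'.prod 𝓘(ℝ, ℝ)) (𝓡 n) Ψ (z, 0))
    {w : EuclideanSpace ℝ (Fin (n + 1))}
    (hd : HasDerivAt (fun τ : ℝ => (Ψ (z, τ) : EuclideanSpace ℝ (Fin (n + 1)))) w 0) :
    incl n (Ψ (z, 0)) (mfderiv (I'.prod 𝓘(ℝ, ℝ)) (𝓡 n) Ψ (z, 0) ((0 : E'), (1 : ℝ))) = w := by
  have hcurve : MDifferentiableAt 𝓘(ℝ, ℝ) (I'.prod 𝓘(ℝ, ℝ)) (fun τ : ℝ => (z, τ)) 0 :=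
    mdifferentiableAt_const.prodMk mdifferentiableAt_id
  have hc : MDifferentiableAt (𝓡 n) 𝓘(ℝ, EuclideanSpace ℝ (Fin (n + 1)))
      (fun y : Sph n => (y : EuclideanSpace ℝ (Fin (n + 1)))) (Ψ (z, 0)) :=
    (contMDiff_coe_sphere (m := 1)).mdifferentiableAt one_ne_zero
  have h1 := mfderiv_comp (0 : ℝ) (hc.comp (z, (0 : ℝ)) hΨ) hcurve
  rw [mfderiv_comp (z, (0 : ℝ)) hc hΨ, mfderiv_prod_right] at h1
  have h2 := DFunLike.congr_fun h1 (1 : ℝ)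
  have h3 : mfderiv 𝓘(ℝ, ℝ) 𝓘(ℝ, EuclideanSpace ℝ (Fin (n + 1)))
      (((fun y : Sph n => (y : EuclideanSpace ℝ (Fin (n + 1)))) ∘ Ψ) ∘ fun τ : ℝ => (z, τ)) 0
        (1 : ℝ) = w := by
    rw [mfderiv_eq_fderiv]
    exact hd.deriv
  exact h2.symm.trans h3

/-- A smooth map to the ambient space which is tangent to the sphere along a map `f` defines a
smooth lift of `f` to the tangent bundle. -/
theorem contMDiff_mk_proj [IsManifold I' ∞ M'] {n : ℕ} {f : M' → Sph n}
    {w : M' → EuclideanSpace ℝ (Fin (n + 1))} (hf : ContMDiff I' (𝓡 n) ∞ f)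
    (hw : ContMDiff I' 𝓘(ℝ, EuclideanSpace ℝ (Fin (n + 1))) ∞ w)
    (hfw : ∀ z, inner ℝ (f z : EuclideanSpace ℝ (Fin (n + 1))) (w z) = 0) :
    ContMDiff I' ((𝓡 n).prod 𝓘(ℝ, EuclideanSpace ℝ (Fin n))) ∞
      (fun z => (Bundle.TotalSpace.mk' (EuclideanSpace ℝ (Fin n)) (f z) (proj n (f z) (w z)) :
        TangentBundle (𝓡 n) (Sph n))) := by
  have : IsManifold I' 1 M' := IsManifold.of_le (n := ∞) (by simp)
  have hne : ∀ z : M' × ℝ, (f z.1 : EuclideanSpace ℝ (Fin (n + 1))) + z.2 • w z.1 ≠ 0 := fun z =>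
    norm_ne_zero_iff.1 (norm_add_smul_ne_zero (f z.1) (hfw z.1) z.2)
  -- The lift is the `τ`-velocity at `τ = 0` of `Ψ`. Hence it is the smooth tangent map of `Ψ`
  -- composed with the smooth section `z ↦ (0_z, ∂_τ)`, and no trivialization has to be computed.
  let Ψ : M' × ℝ → Sph n := fun z =>
    radial n ((f z.1 : EuclideanSpace ℝ (Fin (n + 1))) + z.2 • w z.1)
  have hΨ : ContMDiff (I'.prod 𝓘(ℝ, ℝ)) (𝓡 n) ∞ Ψ := by
    intro z
    have hg : ContMDiff (I'.prod 𝓘(ℝ, ℝ)) 𝓘(ℝ, EuclideanSpace ℝ (Fin (n + 1))) ∞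
        fun z : M' × ℝ => (f z.1 : EuclideanSpace ℝ (Fin (n + 1))) + z.2 • w z.1 :=
      (contMDiff_coe_sphere.comp (hf.comp contMDiff_fst)).add
        (contMDiff_snd.smul (hw.comp contMDiff_fst))
    exact (contMDiffAt_radial (hne z)).comp z (hg z)
  have hT := hΨ.contMDiff_tangentMap (m := ∞) (by simp)
  have hsec : ContMDiff I' ((I'.prod 𝓘(ℝ, ℝ)).tangent) ∞
      (fun z : M' => (equivTangentBundleProd I' M' 𝓘(ℝ, ℝ) ℝ).symm
        (Bundle.zeroSection E' (TangentSpace I' : M' → Type _) z,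
          (Bundle.TotalSpace.mk' ℝ (0 : ℝ) (1 : ℝ) : TangentBundle 𝓘(ℝ, ℝ) ℝ))) :=
    contMDiff_equivTangentBundleProd_symm.comp
      ((Bundle.contMDiff_zeroSection ℝ (TangentSpace I' : M' → Type _)).prodMk contMDiff_const)
  have hcomp := hT.comp hsec
  convert! hcomp using 1
  ext1 z
  have hΨ0 : Ψ (z, 0) = f z := by
    change radial n ((f z : EuclideanSpace ℝ (Fin (n + 1))) + (0 : ℝ) • w z) = f z
    rw [zero_smul, add_zero, radial_coe]
  have hder : HasDerivAt (fun τ : ℝ => (Ψ (z, τ) : EuclideanSpace ℝ (Fin (n + 1)))) (w z) 0 := by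
    have e : (fun τ : ℝ => (Ψ (z, τ) : EuclideanSpace ℝ (Fin (n + 1)))) =
        fun τ : ℝ => ‖(f z : EuclideanSpace ℝ (Fin (n + 1))) + τ • w z‖⁻¹ •
          ((f z : EuclideanSpace ℝ (Fin (n + 1))) + τ • w z) :=
      funext fun τ => coe_radial (hne (z, τ))
    rw [e]
    exact hasDerivAt_normalize (f z) (hfw z)
  exact (mk_eq_mk_proj hΨ0
    (incl_mfderiv_eq_deriv ((hΨ.mdifferentiable (by simp)) (z, 0)) hder)).symm

end Sections

/-! ### The energy density in ambient terms. -/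

/-- The vertical energy density in terms of the value `v` and the differential `A` of the ambient
representation of a vector field on the sphere. -/
def ambientDensity {n : ℕ} (p q : ℝ) (v : EuclideanSpace ℝ (Fin (n + 1)))
    (A : EuclideanSpace ℝ (Fin (n + 1)) →L[ℝ] EuclideanSpace ℝ (Fin (n + 1))) : ℝ :=
  (1 / (1 + ‖v‖ ^ 2)) ^ p *
    (∑ j, ‖A (EuclideanSpace.basisFun (Fin (n + 1)) ℝ j)‖ ^ 2 - ‖v‖ ^ 2 +
      q * ∑ j, inner ℝ (A (EuclideanSpace.basisFun (Fin (n + 1)) ℝ j)) v ^ 2)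

/-- The extension of a vector field on the sphere, seen as a map to the ambient space, to a map
that is constant along rays. -/
def ambient {n : ℕ} (σ : Π x : Sph n, TangentSpace (𝓡 n) x)
    (y : EuclideanSpace ℝ (Fin (n + 1))) : EuclideanSpace ℝ (Fin (n + 1)) :=
  incl n (radial n y) (σ (radial n y))

theorem inner_self_ambient {n : ℕ} (σ : Π x : Sph n, TangentSpace (𝓡 n) x)
    {y : EuclideanSpace ℝ (Fin (n + 1))} (hy : y ≠ 0) : inner ℝ y (ambient σ y) = 0 := by
  have h := inner_incl (radial n y) (σ (radial n y))
  rw [coe_radial hy, inner_smul_left] at h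
  exact (mul_eq_zero.1 h).resolve_left (by simpa using hy)

theorem ambient_smul {n : ℕ} (σ : Π x : Sph n, TangentSpace (𝓡 n) x)
    {y : EuclideanSpace ℝ (Fin (n + 1))} (hy : y ≠ 0) {r : ℝ} (hr : 0 < r) :
    ambient σ (r • y) = ambient σ y := by
  rw [ambient, radial_smul hy hr, ambient]

theorem ambient_coe {n : ℕ} (σ : Π x : Sph n, TangentSpace (𝓡 n) x) (x : Sph n) :
    ambient σ x = incl n x (σ x) := by
  rw [ambient, radial_coe]

theorem fderiv_apply_self_of_ray {E F : Type*} [NormedAddCommGroup E] [NormedSpace ℝ E]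
    [NormedAddCommGroup F] [NormedSpace ℝ F] {f : E → F} {x : E} (hf : DifferentiableAt ℝ f x)
    (hray : ∀ r > (0 : ℝ), f (r • x) = f x) : fderiv ℝ f x x = 0 := by
  have h1 : HasDerivAt (fun r : ℝ => r • x) x 1 := by
    simpa using (hasDerivAt_id (1 : ℝ)).smul_const x
  have hf' : HasFDerivAt f (fderiv ℝ f x) ((1 : ℝ) • x) := by
    rw [one_smul]; exact hf.hasFDerivAt
  have h2 := hf'.comp_hasDerivAt (1 : ℝ) h1
  have h3 : (f ∘ fun r : ℝ => r • x) =ᶠ[nhds 1] fun _ => f x := by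
    filter_upwards [lt_mem_nhds zero_lt_one] with r hr
    exact hray r hr
  exact h2.unique ((hasDerivAt_const (1 : ℝ) (f x)).congr_of_eventuallyEq h3)

/-- Differentiate `⟨y, f y⟩ = 0`: the normal part of the derivative depends only on the value of
`f`. -/
theorem inner_fderiv_of_tangent {E : Type*} [NormedAddCommGroup E] [InnerProductSpace ℝ E]
    {f : E → E} {x : E} (hf : DifferentiableAt ℝ f x)
    (htan : ∀ᶠ y in nhds x, inner ℝ y (f y) = 0) (u : E) :
    inner ℝ x (fderiv ℝ f x u) = - inner ℝ u (f x) := by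
  have h1 : fderiv ℝ (fun y => inner ℝ y (f y)) x u =
      inner ℝ x (fderiv ℝ f x u) + inner ℝ u (f x) := by
    rw [fderiv_inner_apply ℝ differentiableAt_fun_id hf]
    simp
  have h2 : (fun y => inner ℝ y (f y)) =ᶠ[nhds x] fun _ => (0 : ℝ) := htan
  rw [h2.fderiv_eq] at h1
  simp at h1
  linarith

theorem differentiableAt_ambient {n : ℕ} {σ : Π x : Sph n, TangentSpace (𝓡 n) x}
    {y : EuclideanSpace ℝ (Fin (n + 1))} (hy : y ≠ 0)
    (hσ : MDifferentiableAt (𝓡 n) ((𝓡 n).prod 𝓘(ℝ, EuclideanSpace ℝ (Fin n)))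
      (fun y => Bundle.TotalSpace.mk' (EuclideanSpace ℝ (Fin n)) y (σ y)) (radial n y)) :
    DifferentiableAt ℝ (ambient σ) y := by
  have h := (mdifferentiableAt_incl hσ).comp y
    ((contMDiffAt_radial (m := 1) hy).mdifferentiableAt one_ne_zero)
  exact h.differentiableAt

/-- By Pythagoras the projection removes `⟨x, A u⟩² = ⟨u, s⟩²` from `|A u|²`; summed over the
tangent basis, this loss is `|s|²`. -/
theorem sum_norm_proj_sq {n : ℕ} {x : Sph n} {s : TangentSpace (𝓡 n) x}
    {A : EuclideanSpace ℝ (Fin (n + 1)) →L[ℝ] EuclideanSpace ℝ (Fin (n + 1))}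
    (hAx : A x = 0) (hAn : ∀ u, inner ℝ (x : EuclideanSpace ℝ (Fin (n + 1))) (A u) =
      - inner ℝ u (incl n x s))
    {ι : Type*} [Fintype ι] (e : OrthonormalBasis ι ℝ (TangentSpace (𝓡 n) x))
    {κ : Type*} [Fintype κ] (b : OrthonormalBasis κ ℝ (EuclideanSpace ℝ (Fin (n + 1)))) :
    ∑ i, inner ℝ (proj n x (A (incl n x (e i)))) (proj n x (A (incl n x (e i)))) =
      ∑ j, ‖A (b j)‖ ^ 2 - ‖s‖ ^ 2 := by
  have h1 : ∀ i, inner ℝ (proj n x (A (incl n x (e i)))) (proj n x (A (incl n x (e i)))) =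
      inner ℝ (incl n x (e i)) ((A.adjoint ∘L A) (incl n x (e i))) - inner ℝ (e i) s ^ 2 := by
    intro i
    have h2 : inner ℝ (x : EuclideanSpace ℝ (Fin (n + 1))) (A (incl n x (e i))) =
        - inner ℝ (e i) s := by rw [hAn, inner_tangent]
    rw [proj, ContinuousLinearMap.adjoint_inner_left, ← proj, incl_proj, inner_sub_right,
      inner_smul_right, real_inner_comm (x : EuclideanSpace ℝ (Fin (n + 1))), h2,
      ContinuousLinearMap.comp_apply, ContinuousLinearMap.adjoint_inner_right]
    ring
  have h3 := sum_inner_incl x (A.adjoint ∘L A)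
    (by rw [ContinuousLinearMap.comp_apply, hAx, map_zero]) e b
  simp only [h1, Finset.sum_sub_distrib]
  rw [h3, e.sum_sq_inner_right s]
  congr 1
  refine Finset.sum_congr rfl fun j _ => ?_
  rw [ContinuousLinearMap.comp_apply, ContinuousLinearMap.adjoint_inner_right,
    real_inner_self_eq_norm_sq]

theorem sum_inner_proj_sq {n : ℕ} {x : Sph n} {s : TangentSpace (𝓡 n) x}
    {A : EuclideanSpace ℝ (Fin (n + 1)) →L[ℝ] EuclideanSpace ℝ (Fin (n + 1))}
    (hAx : A x = 0)
    {ι : Type*} [Fintype ι] (e : OrthonormalBasis ι ℝ (TangentSpace (𝓡 n) x))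
    {κ : Type*} [Fintype κ] (b : OrthonormalBasis κ ℝ (EuclideanSpace ℝ (Fin (n + 1)))) :
    ∑ i, inner ℝ (proj n x (A (incl n x (e i)))) s * inner ℝ (proj n x (A (incl n x (e i)))) s =
      ∑ j, inner ℝ (A (b j)) (incl n x s) ^ 2 := by
  -- The sum is the trace of the rank-one operator `u ↦ ⟨w, u⟩ w`, which kills `x` because `A x =
  -- 0`.
  set w := A.adjoint (incl n x s)
  have key : ∀ u : EuclideanSpace ℝ (Fin (n + 1)),
      inner ℝ u ((innerSL ℝ w).smulRight w u) = inner ℝ (A u) (incl n x s) ^ 2 := fun u => by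
    rw [ContinuousLinearMap.smulRight_apply, inner_smul_right, innerSL_apply_apply,
      real_inner_comm u w, ContinuousLinearMap.adjoint_inner_right, pow_two]
  have h4 := sum_inner_incl x ((innerSL ℝ w).smulRight w) (by
    rw [ContinuousLinearMap.smulRight_apply, innerSL_apply_apply,
      ContinuousLinearMap.adjoint_inner_left, hAx, inner_zero_right, zero_smul]) e b
  simp only [key] at h4
  rw [← h4]
  refine Finset.sum_congr rfl fun i _ => ?_
  rw [proj, ContinuousLinearMap.adjoint_inner_left, pow_two]

theorem leviCivita_apply {n : ℕ} {σ : Π x : Sph n, TangentSpace (𝓡 n) x} {x : Sph n}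
    (hσ : MDifferentiableAt (𝓡 n) ((𝓡 n).prod 𝓘(ℝ, EuclideanSpace ℝ (Fin n)))
      (fun y => Bundle.TotalSpace.mk' (EuclideanSpace ℝ (Fin n)) y (σ y)) x)
    (u : TangentSpace (𝓡 n) x) :
    leviCivita n σ x u = proj n x (fderiv ℝ (ambient σ) x (incl n x u)) := by
  change proj n x (mvfderiv (𝓡 n) (fun y : Sph n => incl n y (σ y)) x u) = _
  rw [mvfderiv_eq_fderiv (mdifferentiableAt_incl hσ)]
  rfl

theorem vertDensity_eq {n : ℕ} (p q : ℝ) {σ : Π x : Sph n, TangentSpace (𝓡 n) x} {x : Sph n}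
    (hσ : MDifferentiableAt (𝓡 n) ((𝓡 n).prod 𝓘(ℝ, EuclideanSpace ℝ (Fin n)))
      (fun y => Bundle.TotalSpace.mk' (EuclideanSpace ℝ (Fin n)) y (σ y)) x) :
    vertDensity (leviCivita n) p q σ x = ambientDensity p q (ambient σ x)
      (fderiv ℝ (ambient σ) x) := by
  have hd : DifferentiableAt ℝ (ambient σ) (x : EuclideanSpace ℝ (Fin (n + 1))) :=
    differentiableAt_ambient (sph_ne_zero x) (by rwa [radial_coe])
  have hAx : fderiv ℝ (ambient σ) x x = 0 :=
    fderiv_apply_self_of_ray hd fun r hr => ambient_smul σ (sph_ne_zero x) hr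
  have hAn : ∀ u, inner ℝ (x : EuclideanSpace ℝ (Fin (n + 1))) (fderiv ℝ (ambient σ) x u) =
      - inner ℝ u (incl n x (σ x)) := by
    rw [← ambient_coe]
    refine inner_fderiv_of_tangent hd ?_
    filter_upwards [isOpen_compl_singleton.mem_nhds (sph_ne_zero x)] with y hy
    exact inner_self_ambient σ hy
  simp only [vertDensity, vertForm, leviCivita_apply hσ]
  rw [← Finset.mul_sum, Finset.sum_add_distrib, ← Finset.mul_sum,
    sum_norm_proj_sq hAx hAn _ (EuclideanSpace.basisFun (Fin (n + 1)) ℝ),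
    sum_inner_proj_sq hAx _ (EuclideanSpace.basisFun (Fin (n + 1)) ℝ), ambientDensity,
    ambient_coe, norm_incl]

/-! ### Differentiating the energy along a variation. -/

/-- The ambient representation of a one-parameter family of vector fields. -/
def ambientFamily {n : ℕ} (s : ℝ → Π x : Sph n, TangentSpace (𝓡 n) x)
    (z : EuclideanSpace ℝ (Fin (n + 1)) × ℝ) : EuclideanSpace ℝ (Fin (n + 1)) :=
  ambient (s z.2) z.1

theorem contDiffAt_ambientFamily {n : ℕ} {σ : Π x : Sph n, TangentSpace (𝓡 n) x}
    {s : ℝ → Π x : Sph n, TangentSpace (𝓡 n) x}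
    (hs : IsSmoothVariation (𝓡 n) (EuclideanSpace ℝ (Fin n)) σ s)
    {z : EuclideanSpace ℝ (Fin (n + 1)) × ℝ} (hz : z.1 ≠ 0) :
    ContDiffAt ℝ ∞ (ambientFamily s) z := by
  have h1 := contMDiff_incl hs.1
  have h2 : ContMDiffAt 𝓘(ℝ, EuclideanSpace ℝ (Fin (n + 1)) × ℝ) ((𝓡 n).prod 𝓘(ℝ, ℝ)) ∞
      (fun z : EuclideanSpace ℝ (Fin (n + 1)) × ℝ => (radial n z.1, z.2)) z :=
    ((contMDiffAt_radial hz).comp z contDiffAt_fst.contMDiffAt).prodMk contDiffAt_snd.contMDiffAt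
  exact (h1.contMDiffAt.comp z h2).contDiffAt

theorem mdifferentiable_of_variation {n : ℕ} {σ : Π x : Sph n, TangentSpace (𝓡 n) x}
    {s : ℝ → Π x : Sph n, TangentSpace (𝓡 n) x}
    (hs : IsSmoothVariation (𝓡 n) (EuclideanSpace ℝ (Fin n)) σ s) (t : ℝ) :
    MDifferentiable (𝓡 n) ((𝓡 n).prod 𝓘(ℝ, EuclideanSpace ℝ (Fin n)))
      (fun y => (Bundle.TotalSpace.mk' (EuclideanSpace ℝ (Fin n)) y (s t y) :
        TangentBundle (𝓡 n) (Sph n))) := by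
  have h := hs.1.comp (contMDiff_id.prodMk (contMDiff_const (c := t)) :
    ContMDiff (𝓡 n) ((𝓡 n).prod 𝓘(ℝ, ℝ)) ∞ fun y : Sph n => (y, t))
  exact h.mdifferentiable (by simp)

theorem vertDensity_variation {n : ℕ} (p q : ℝ) {σ : Π x : Sph n, TangentSpace (𝓡 n) x}
    {s : ℝ → Π x : Sph n, TangentSpace (𝓡 n) x}
    (hs : IsSmoothVariation (𝓡 n) (EuclideanSpace ℝ (Fin n)) σ s) (t : ℝ) (x : Sph n) :
    vertDensity (leviCivita n) p q (s t) x = ambientDensity p q (ambientFamily s (x, t))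
      (fderiv ℝ (ambientFamily s) (x, t) ∘L ContinuousLinearMap.inl ℝ _ _) := by
  rw [vertDensity_eq p q (mdifferentiable_of_variation hs t x)]
  congr 1
  have h : HasFDerivAt (ambientFamily s)
      (fderiv ℝ (ambientFamily s) ((x : EuclideanSpace ℝ (Fin (n + 1))), t))
      ((x : EuclideanSpace ℝ (Fin (n + 1))), t) :=
    ((contDiffAt_ambientFamily hs (sph_ne_zero x)).differentiableAt (by simp)).hasFDerivAt
  have h' : HasFDerivAt (𝕜 := ℝ) (fun e : EuclideanSpace ℝ (Fin (n + 1)) => (e, t))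
      (ContinuousLinearMap.inl ℝ (EuclideanSpace ℝ (Fin (n + 1))) ℝ) x :=
    hasFDerivAt_prodMk_left _ t
  exact (HasFDerivAt.comp (f := fun e : EuclideanSpace ℝ (Fin (n + 1)) => (e, t)) _ h h').fderiv

instance sphereVolFinite (n : ℕ) : IsFiniteMeasure (sphereVol n) := by
  unfold sphereVol; infer_instance

instance sphereVolOpenPos (n : ℕ) : (sphereVol n).IsOpenPosMeasure := by
  unfold sphereVol; infer_instance

/-- Differentiation under the integral sign for functions which are `C¹` on
`(ℝ^(n+1) ∖ 0) × ℝ`. -/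
theorem hasDerivAt_integral_sphere {n : ℕ} {G : EuclideanSpace ℝ (Fin (n + 1)) × ℝ → ℝ}
    (hG : ∀ z, z.1 ≠ 0 → ContDiffAt ℝ 1 G z) :
    HasDerivAt (fun t => ∫ x : Sph n, G (x, t) ∂sphereVol n)
      (∫ x : Sph n, fderiv ℝ G (x, 0) (0, 1) ∂sphereVol n) 0 := by
  have hc : Continuous fun z : Sph n × ℝ => fderiv ℝ G ((z.1 : EuclideanSpace ℝ (Fin (n + 1))), z.2)
      ((0 : EuclideanSpace ℝ (Fin (n + 1))), (1 : ℝ)) := by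
    rw [continuous_iff_continuousAt]
    intro z
    have h1 : ContinuousAt (fderiv ℝ G) ((z.1 : EuclideanSpace ℝ (Fin (n + 1))), z.2) :=
      (((hG _ (sph_ne_zero z.1)).fderiv_right (m := 0) (by simp)).continuousAt)
    have h2 : ContinuousAt
        (fun z : Sph n × ℝ => ((z.1 : EuclideanSpace ℝ (Fin (n + 1))), z.2)) z := by fun_prop
    exact (ContinuousAt.comp (f := fun z : Sph n × ℝ =>
      ((z.1 : EuclideanSpace ℝ (Fin (n + 1))), z.2)) h1 h2).clm_apply continuousAt_const
  have hcG : ∀ t : ℝ, Continuous fun x : Sph n => G (x, t) := fun t => by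
    rw [continuous_iff_continuousAt]
    intro x
    exact ContinuousAt.comp (f := fun x : Sph n => ((x : EuclideanSpace ℝ (Fin (n + 1))), t))
      (hG _ (sph_ne_zero x)).continuousAt (by fun_prop)
  -- Compactness of `S^n × [-1, 1]` supplies a constant dominating function.
  obtain ⟨C, hC⟩ := ((isCompact_univ (X := Sph n)).prod
    (isCompact_Icc (a := (-1 : ℝ)) (b := 1))).exists_bound_of_continuousOn hc.continuousOn
  refine (hasDerivAt_integral_of_dominated_loc_of_deriv_le (bound := fun _ => C)
    (F := fun t (x : Sph n) => G (x, t))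
    (F' := fun t (x : Sph n) => fderiv ℝ G (x, t) (0, 1))
    (Icc_mem_nhds (a := (-1 : ℝ)) (b := 1) (by norm_num) (by norm_num)) ?_ ?_ ?_ ?_ ?_ ?_).2
  · exact .of_forall fun t => (hcG t).aestronglyMeasurable
  · exact (hcG 0).integrable_of_hasCompactSupport (HasCompactSupport.of_compactSpace _)
  · exact (hc.comp (continuous_id.prodMk continuous_const)).aestronglyMeasurable
  · exact .of_forall fun x t ht => hC (x, t) ⟨mem_univ _, ht⟩
  · exact integrable_const C
  · refine .of_forall fun x t _ => ?_
    have h1 : HasFDerivAt G (fderiv ℝ G ((x : EuclideanSpace ℝ (Fin (n + 1))), t))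
        ((x : EuclideanSpace ℝ (Fin (n + 1))), t) :=
      ((hG _ (sph_ne_zero x)).differentiableAt one_ne_zero).hasFDerivAt
    exact HasFDerivAt.comp_hasDerivAt
      (f := fun t : ℝ => ((x : EuclideanSpace ℝ (Fin (n + 1))), t)) t h1
      ((hasDerivAt_const t _).prodMk (hasDerivAt_id t))

/-- The derivative of `ambientDensity` at `(v, A)` in the direction `(v', A')`. -/
def ambientDensityDeriv {n : ℕ} (p q : ℝ) (v v' : EuclideanSpace ℝ (Fin (n + 1)))
    (A A' : EuclideanSpace ℝ (Fin (n + 1)) →L[ℝ] EuclideanSpace ℝ (Fin (n + 1))) : ℝ :=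
  (1 / (1 + ‖v‖ ^ 2)) ^ p *
    (∑ j, 2 * inner ℝ (A (EuclideanSpace.basisFun (Fin (n + 1)) ℝ j))
        (A' (EuclideanSpace.basisFun (Fin (n + 1)) ℝ j)) - 2 * inner ℝ v v' +
      q * ∑ j, 2 * inner ℝ (A (EuclideanSpace.basisFun (Fin (n + 1)) ℝ j)) v *
        (inner ℝ (A (EuclideanSpace.basisFun (Fin (n + 1)) ℝ j)) v' +
          inner ℝ (A' (EuclideanSpace.basisFun (Fin (n + 1)) ℝ j)) v)) -
  2 * p * inner ℝ v v' * (1 / (1 + ‖v‖ ^ 2)) ^ (p + 1) *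
    (∑ j, ‖A (EuclideanSpace.basisFun (Fin (n + 1)) ℝ j)‖ ^ 2 - ‖v‖ ^ 2 +
      q * ∑ j, inner ℝ (A (EuclideanSpace.basisFun (Fin (n + 1)) ℝ j)) v ^ 2)

theorem hasDerivAt_weight_rpow {E : Type*} [NormedAddCommGroup E] [InnerProductSpace ℝ E]
    (p : ℝ) {v : ℝ → E} {v' : E} {t : ℝ} (hv : HasDerivAt v v' t) :
    HasDerivAt (fun t => (1 / (1 + ‖v t‖ ^ 2)) ^ p)
      (-(2 * p * inner ℝ (v t) v' * (1 / (1 + ‖v t‖ ^ 2)) ^ (p + 1))) t := by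
  have hpos : 0 < 1 + ‖v t‖ ^ 2 := by positivity
  have h1 : HasDerivAt (fun t => 1 / (1 + ‖v t‖ ^ 2))
      (-(2 * inner ℝ (v t) v') / (1 + ‖v t‖ ^ 2) ^ 2) t := by
    simpa using (hv.norm_sq.const_add 1).fun_inv hpos.ne'
  have h2 := h1.rpow_const (p := p) (Or.inl (by positivity))
  convert! h2 using 1
  -- The power rule leaves the exponent `p - 1`, and the derivative of `1/(1+|v|²)` contributes two
  -- more factors of the weight.
  have h3 : (1 / (1 + ‖v t‖ ^ 2)) ^ (p + 1) =
      (1 / (1 + ‖v t‖ ^ 2)) ^ (p - 1) * (1 / (1 + ‖v t‖ ^ 2)) ^ 2 := by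
    rw [← Real.rpow_add_natCast (by positivity)]
    congr 1
    push_cast
    ring
  rw [h3]
  field_simp

theorem hasDerivAt_ambientDensity {n : ℕ} (p q : ℝ) {v : ℝ → EuclideanSpace ℝ (Fin (n + 1))}
    {A : ℝ → EuclideanSpace ℝ (Fin (n + 1)) →L[ℝ] EuclideanSpace ℝ (Fin (n + 1))}
    {v' : EuclideanSpace ℝ (Fin (n + 1))}
    {A' : EuclideanSpace ℝ (Fin (n + 1)) →L[ℝ] EuclideanSpace ℝ (Fin (n + 1))} {t : ℝ}
    (hv : HasDerivAt v v' t) (hA : HasDerivAt A A' t) :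
    HasDerivAt (fun t => ambientDensity p q (v t) (A t))
      (ambientDensityDeriv p q (v t) v' (A t) A') t := by
  have hAe : ∀ u, HasDerivAt (fun t => A t u) (A' u) t := fun u => by
    simpa using hA.clm_apply (hasDerivAt_const t u)
  have h1 := HasDerivAt.fun_sum (u := Finset.univ)
    fun j _ => (hAe (EuclideanSpace.basisFun (Fin (n + 1)) ℝ j)).norm_sq
  have h2 := HasDerivAt.fun_sum (u := Finset.univ)
    fun j _ => ((hAe (EuclideanSpace.basisFun (Fin (n + 1)) ℝ j)).inner ℝ hv).fun_pow 2
  have h := (hasDerivAt_weight_rpow p hv).fun_mul ((h1.fun_sub hv.norm_sq).fun_add (h2.const_mul q))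
  refine h.congr_deriv ?_
  simp only [ambientDensityDeriv, Nat.cast_ofNat, Nat.add_one_sub_one, pow_one]
  ring

theorem contDiffAt_ambientDensity {n : ℕ} (p q : ℝ) {F : Type*} [NormedAddCommGroup F]
    [NormedSpace ℝ F] {v : F → EuclideanSpace ℝ (Fin (n + 1))}
    {A : F → EuclideanSpace ℝ (Fin (n + 1)) →L[ℝ] EuclideanSpace ℝ (Fin (n + 1))} {z : F}
    {m : ℕ∞ω} (hv : ContDiffAt ℝ m v z) (hA : ContDiffAt ℝ m A z) :
    ContDiffAt ℝ m (fun z => ambientDensity p q (v z) (A z)) z := by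
  have hAe : ∀ u, ContDiffAt ℝ m (fun z => A z u) z := fun u => hA.clm_apply contDiffAt_const
  have hpos : 1 + ‖v z‖ ^ 2 ≠ 0 := by positivity
  unfold ambientDensity
  refine ContDiffAt.mul ?_ ?_
  · refine ContDiffAt.rpow_const_of_ne ?_ (by positivity)
    exact contDiffAt_const.div (contDiffAt_const.add (hv.norm_sq ℝ)) hpos
  · refine ((ContDiffAt.sum fun j _ => (hAe _).norm_sq ℝ).sub (hv.norm_sq ℝ)).add ?_
    exact contDiffAt_const.mul (ContDiffAt.sum fun j _ => ((hAe _).inner ℝ hv).pow 2)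

/-- The variation field `∂_t s_t` at `t = 0` in the ambient representation. -/
def variationField {n : ℕ} (s : ℝ → Π x : Sph n, TangentSpace (𝓡 n) x)
    (y : EuclideanSpace ℝ (Fin (n + 1))) : EuclideanSpace ℝ (Fin (n + 1)) :=
  deriv (fun t => ambient (s t) y) 0

section Variation

variable {n : ℕ} {σ : Π x : Sph n, TangentSpace (𝓡 n) x}
  {s : ℝ → Π x : Sph n, TangentSpace (𝓡 n) x}

theorem hasDerivAt_ambientFamily
    (hs : IsSmoothVariation (𝓡 n) (EuclideanSpace ℝ (Fin n)) σ s)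
    {y : EuclideanSpace ℝ (Fin (n + 1))} (hy : y ≠ 0) (t : ℝ) :
    HasDerivAt (fun t => ambient (s t) y) (fderiv ℝ (ambientFamily s) (y, t) (0, 1)) t := by
  have h1 : HasFDerivAt (ambientFamily s) (fderiv ℝ (ambientFamily s) (y, t)) (y, t) :=
    ((contDiffAt_ambientFamily hs (z := (y, t)) hy).differentiableAt (by simp)).hasFDerivAt
  exact HasFDerivAt.comp_hasDerivAt (f := fun t : ℝ => (y, t)) t h1
    ((hasDerivAt_const t y).prodMk (hasDerivAt_id t))

theorem variationField_eq
    (hs : IsSmoothVariation (𝓡 n) (EuclideanSpace ℝ (Fin n)) σ s)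
    {y : EuclideanSpace ℝ (Fin (n + 1))} (hy : y ≠ 0) :
    variationField s y = fderiv ℝ (ambientFamily s) (y, 0) (0, 1) :=
  (hasDerivAt_ambientFamily hs hy 0).deriv

theorem variationField_smul {y : EuclideanSpace ℝ (Fin (n + 1))} (hy : y ≠ 0) {r : ℝ}
    (hr : 0 < r) : variationField s (r • y) = variationField s y := by
  simp only [variationField, ambient_smul _ hy hr]

theorem inner_variationField
    (hs : IsSmoothVariation (𝓡 n) (EuclideanSpace ℝ (Fin n)) σ s)
    {y : EuclideanSpace ℝ (Fin (n + 1))} (hy : y ≠ 0) :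
    inner ℝ y (variationField s y) = 0 := by
  rw [variationField_eq hs hy]
  have h1 := (hasDerivAt_const (0 : ℝ) y).inner ℝ (hasDerivAt_ambientFamily hs hy 0)
  simp only [inner_self_ambient _ hy, inner_zero_left, add_zero] at h1
  exact h1.unique (hasDerivAt_const (0 : ℝ) (0 : ℝ))

theorem contDiffAt_variationField
    (hs : IsSmoothVariation (𝓡 n) (EuclideanSpace ℝ (Fin n)) σ s)
    {y : EuclideanSpace ℝ (Fin (n + 1))} (hy : y ≠ 0) :
    ContDiffAt ℝ ∞ (variationField s) y := by
  have h1 : ContDiffAt ℝ ∞ (fderiv ℝ (ambientFamily s)) (y, 0) :=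
    (contDiffAt_ambientFamily hs (z := (y, 0)) hy).fderiv_right (by simp)
  have h2 : ContDiffAt ℝ ∞ (fun y : EuclideanSpace ℝ (Fin (n + 1)) => (y, (0 : ℝ))) y :=
    contDiffAt_id.prodMk contDiffAt_const
  have h3 : ContDiffAt ℝ ∞ (fun y => fderiv ℝ (ambientFamily s) (y, 0) (0, 1)) y :=
    (h1.comp y h2).clm_apply contDiffAt_const
  refine h3.congr_of_eventuallyEq ?_
  filter_upwards [isOpen_compl_singleton.mem_nhds hy] with z hz
  exact variationField_eq hs hz

/-- The time derivative of the spatial differential is the differential of the variation field. -/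
theorem hasDerivAt_fderiv_ambientFamily
    (hs : IsSmoothVariation (𝓡 n) (EuclideanSpace ℝ (Fin n)) σ s)
    {y : EuclideanSpace ℝ (Fin (n + 1))} (hy : y ≠ 0) :
    HasDerivAt (fun t => fderiv ℝ (ambientFamily s) (y, t) ∘L ContinuousLinearMap.inl ℝ _ _)
      (fderiv ℝ (variationField s) y) 0 := by
  have hV := contDiffAt_ambientFamily hs (z := (y, 0)) hy
  have h1 : HasFDerivAt (fderiv ℝ (ambientFamily s)) (fderiv ℝ (fderiv ℝ (ambientFamily s)) (y, 0))
      (y, 0) := ((hV.fderiv_right (m := ∞) (by simp)).differentiableAt (by simp)).hasFDerivAt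
  have h2 : HasDerivAt (fun t => fderiv ℝ (ambientFamily s) (y, t))
      (fderiv ℝ (fderiv ℝ (ambientFamily s)) (y, 0) (0, 1)) 0 :=
    HasFDerivAt.comp_hasDerivAt (f := fun t : ℝ => (y, t)) 0 h1
      ((hasDerivAt_const 0 y).prodMk (hasDerivAt_id 0))
  have h3 := h2.clm_comp (hasDerivAt_const (0 : ℝ)
    (ContinuousLinearMap.inl ℝ (EuclideanSpace ℝ (Fin (n + 1))) ℝ))
  refine h3.congr_deriv ?_
  have h4 : HasFDerivAt (𝕜 := ℝ) (fun e : EuclideanSpace ℝ (Fin (n + 1)) => (e, (0 : ℝ)))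
      (ContinuousLinearMap.inl ℝ (EuclideanSpace ℝ (Fin (n + 1))) ℝ) y :=
    hasFDerivAt_prodMk_left _ 0
  have h5 := (HasFDerivAt.comp (f := fun e : EuclideanSpace ℝ (Fin (n + 1)) => (e, (0 : ℝ)))
    y h1 h4).clm_apply
    (hasFDerivAt_const ((0 : EuclideanSpace ℝ (Fin (n + 1))), (1 : ℝ)) y)
  have h6 : variationField s =ᶠ[nhds y]
      fun y => fderiv ℝ (ambientFamily s) (y, 0) (0, 1) := by
    filter_upwards [isOpen_compl_singleton.mem_nhds hy] with z hz
    exact variationField_eq hs hz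
  rw [h6.fderiv_eq]
  refine Eq.trans ?_ h5.fderiv.symm
  ext1 u
  -- Symmetry of the second derivative exchanges the time and space directions.
  have h7 := (hV.isSymmSndFDerivAt
    (by rw [minSmoothness_of_isRCLikeNormedField]; norm_cast)).eq ((0 : EuclideanSpace ℝ (Fin (n + 1))), (1 : ℝ))
    (u, 0)
  simpa using h7

theorem hasDerivAt_vertEnergy (p q : ℝ)
    (hs : IsSmoothVariation (𝓡 n) (EuclideanSpace ℝ (Fin n)) σ s) :
    HasDerivAt (fun t => vertEnergy (sphereVol n) (leviCivita n) p q (s t))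
      (1 / 2 * ∫ x : Sph n, ambientDensityDeriv p q (ambient σ x) (variationField s x)
        (fderiv ℝ (ambient σ) x) (fderiv ℝ (variationField s) x) ∂sphereVol n) 0 := by
  let G : EuclideanSpace ℝ (Fin (n + 1)) × ℝ → ℝ := fun z =>
    ambientDensity p q (ambientFamily s z)
      (fderiv ℝ (ambientFamily s) z ∘L ContinuousLinearMap.inl ℝ _ _)
  have hG : ∀ z, z.1 ≠ 0 → ContDiffAt ℝ 1 G z := fun z hz => by
    have hV := contDiffAt_ambientFamily hs hz
    exact contDiffAt_ambientDensity p q (hV.of_le (by simp))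
      ((hV.fderiv_right (m := 1) (by norm_cast)).clm_comp contDiffAt_const)
  have h1 := (hasDerivAt_integral_sphere hG).const_mul (1 / 2)
  simp only [vertEnergy, vertDensity_variation p q hs]
  refine h1.congr_deriv ?_
  congr 1
  refine integral_congr_ae (.of_forall fun x => ?_)
  have hx := sph_ne_zero x
  have h2 : HasFDerivAt G (fderiv ℝ G ((x : EuclideanSpace ℝ (Fin (n + 1))), 0))
      ((x : EuclideanSpace ℝ (Fin (n + 1))), 0) :=
    ((hG _ hx).differentiableAt one_ne_zero).hasFDerivAt
  have h3 := HasFDerivAt.comp_hasDerivAt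
      (f := fun t : ℝ => ((x : EuclideanSpace ℝ (Fin (n + 1))), t)) 0 h2
      ((hasDerivAt_const 0 _).prodMk (hasDerivAt_id 0))
  have h4 := hasDerivAt_ambientDensity p q (hasDerivAt_ambientFamily hs hx 0)
    (hasDerivAt_fderiv_ambientFamily hs hx)
  -- The same time derivative, once as `fderiv G` in the direction `(0, 1)` and once by the explicit
  -- formula.
  have h5 := h3.unique h4
  have h6 : fderiv ℝ (ambientFamily s) ((x : EuclideanSpace ℝ (Fin (n + 1))), 0) ∘L
      ContinuousLinearMap.inl ℝ _ _ = fderiv ℝ (ambient σ) x := by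
    have h : HasFDerivAt (ambientFamily s)
        (fderiv ℝ (ambientFamily s) ((x : EuclideanSpace ℝ (Fin (n + 1))), 0))
        ((x : EuclideanSpace ℝ (Fin (n + 1))), 0) :=
      ((contDiffAt_ambientFamily hs hx).differentiableAt (by simp)).hasFDerivAt
    have h' : HasFDerivAt (𝕜 := ℝ) (fun e : EuclideanSpace ℝ (Fin (n + 1)) => (e, (0 : ℝ)))
        (ContinuousLinearMap.inl ℝ (EuclideanSpace ℝ (Fin (n + 1))) ℝ) x :=
      hasFDerivAt_prodMk_left _ 0
    rw [← hs.2]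
    exact (HasFDerivAt.comp (f := fun e : EuclideanSpace ℝ (Fin (n + 1)) => (e, (0 : ℝ)))
      _ h h').fderiv.symm
  rw [h6, ← variationField_eq hs hx, hs.2] at h5
  exact h5

end Variation

/-! ### The conformal gradient field and its differential. -/

theorem mvfderiv_inner_coe {n : ℕ} (a : EuclideanSpace ℝ (Fin (n + 1))) (x : Sph n)
    (u : TangentSpace (𝓡 n) x) :
    mvfderiv (𝓡 n) (fun y : Sph n => (inner ℝ a (y : EuclideanSpace ℝ (Fin (n + 1))) : ℝ)) x u =
      inner ℝ a (incl n x u) := by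
  have hc : MDifferentiableAt (𝓡 n) 𝓘(ℝ, EuclideanSpace ℝ (Fin (n + 1)))
      (fun y : Sph n => (y : EuclideanSpace ℝ (Fin (n + 1)))) x :=
    (contMDiff_coe_sphere (m := 1)).mdifferentiableAt one_ne_zero
  have h := mfderiv_comp x ((innerSL ℝ a).differentiableAt.mdifferentiableAt) hc
  rw [mfderiv_eq_fderiv, ContinuousLinearMap.fderiv] at h
  exact DFunLike.congr_fun h u

theorem conformalGradientField_eq {n : ℕ} (a : EuclideanSpace ℝ (Fin (n + 1))) (x : Sph n) :
    conformalGradientField n a x = proj n x a := by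
  refine ext_inner_right ℝ fun v => ?_
  rw [proj, ContinuousLinearMap.adjoint_inner_left, conformalGradientField, grad,
    InnerProductSpace.toDual_symm_apply, mvfderiv_inner_coe]

theorem incl_conformalGradientField {n : ℕ} (a : EuclideanSpace ℝ (Fin (n + 1))) (x : Sph n) :
    incl n x (conformalGradientField n a x) =
      a - inner ℝ a (x : EuclideanSpace ℝ (Fin (n + 1))) • (x : EuclideanSpace ℝ (Fin (n + 1))) := by
  rw [conformalGradientField_eq, incl_proj, real_inner_comm]

theorem norm_sq_conformalGradientField {n : ℕ} (a : EuclideanSpace ℝ (Fin (n + 1))) (x : Sph n) :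
    ‖conformalGradientField n a x‖ ^ 2 =
      ‖a‖ ^ 2 - inner ℝ a (x : EuclideanSpace ℝ (Fin (n + 1))) ^ 2 := by
  rw [← norm_incl, incl_conformalGradientField, norm_sub_sq_real, inner_smul_right, norm_smul,
    mul_pow, sph_norm, Real.norm_eq_abs, sq_abs]
  ring

theorem ambient_conformalGradientField {n : ℕ} (a : EuclideanSpace ℝ (Fin (n + 1)))
    {y : EuclideanSpace ℝ (Fin (n + 1))} (hy : y ≠ 0) :
    ambient (conformalGradientField n a) y = a - ((‖y‖ ^ 2)⁻¹ * inner ℝ a y) • y := by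
  rw [ambient, incl_conformalGradientField, coe_radial hy, inner_smul_right, smul_smul]
  congr 2
  have := norm_ne_zero_iff.2 hy
  field_simp

theorem isSmoothSection_conformalGradientField {n : ℕ} (a : EuclideanSpace ℝ (Fin (n + 1))) :
    IsSmoothSection (𝓡 n) (EuclideanSpace ℝ (Fin n)) (conformalGradientField n a) := by
  have h := contMDiff_mk_proj (I' := 𝓡 n) (M' := Sph n) (f := id)
    (w := fun x => a - inner ℝ a (x : EuclideanSpace ℝ (Fin (n + 1))) •
      (x : EuclideanSpace ℝ (Fin (n + 1)))) contMDiff_id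
    (by
      have h1 : ContDiff ℝ ∞ fun y : EuclideanSpace ℝ (Fin (n + 1)) => a - inner ℝ a y • y :=
        contDiff_const.sub ((contDiff_const.inner ℝ contDiff_id).smul contDiff_id)
      exact h1.contMDiff.comp contMDiff_coe_sphere)
    (fun x => by rw [id, ← incl_conformalGradientField, inner_incl])
  unfold IsSmoothSection
  convert! h using 3 with x
  exact (proj_incl _).symm.trans (by rw [incl_conformalGradientField]; rfl)

/-- The differential of `y ↦ ⟨a, y⟩ / |y|²` at a unit vector. -/
theorem hasFDerivAt_inner_div_norm_sq {E : Type*} [NormedAddCommGroup E] [InnerProductSpace ℝ E]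
    (a : E) {x : E} (hx : ‖x‖ = 1) :
    HasFDerivAt (fun y => (‖y‖ ^ 2)⁻¹ * inner ℝ a y)
      (innerSL ℝ a - (2 * inner ℝ a x) • innerSL ℝ x) x := by
  have h1 : HasFDerivAt (fun y : E => (‖y‖ ^ 2)⁻¹) (-(2 : ℝ) • innerSL ℝ x) x := by
    have h2 := (hasDerivAt_inv (x := ‖x‖ ^ 2) (by simp [hx])).comp_hasFDerivAt x
      (HasStrictFDerivAt.hasFDerivAt (hasStrictFDerivAt_norm_sq x))
    refine h2.congr_fderiv ?_
    ext u
    simp [hx]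
  refine (h1.mul (innerSL ℝ a).hasFDerivAt).congr_fderiv ?_
  ext u
  simp [hx]
  ring

/-- The last term is `∇_u σ = -λu` for tangent `u`; the multiple of `x` is the normal part forced by
tangency. -/
theorem fderiv_ambient_conformalGradientField {n : ℕ} (a : EuclideanSpace ℝ (Fin (n + 1)))
    (x : Sph n) (u : EuclideanSpace ℝ (Fin (n + 1))) :
    fderiv ℝ (ambient (conformalGradientField n a)) x u =
      -(inner ℝ (ambient (conformalGradientField n a) x) u) • (x : EuclideanSpace ℝ (Fin (n + 1))) -
      inner ℝ a (x : EuclideanSpace ℝ (Fin (n + 1))) •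
        (u - inner ℝ (x : EuclideanSpace ℝ (Fin (n + 1))) u •
          (x : EuclideanSpace ℝ (Fin (n + 1)))) := by
  have h1 : ambient (conformalGradientField n a) =ᶠ[nhds (x : EuclideanSpace ℝ (Fin (n + 1)))]
      fun y => a - ((‖y‖ ^ 2)⁻¹ * inner ℝ a y) • y := by
    filter_upwards [isOpen_compl_singleton.mem_nhds (sph_ne_zero x)] with y hy
    exact ambient_conformalGradientField a hy
  have h2 := ((hasFDerivAt_inner_div_norm_sq a (sph_norm x)).smul
    (hasFDerivAt_id (𝕜 := ℝ) (x : EuclideanSpace ℝ (Fin (n + 1))))).const_sub a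
  rw [h1.fderiv_eq, ambient_conformalGradientField a (sph_ne_zero x)]
  refine (DFunLike.congr_fun h2.fderiv u).trans ?_
  simp [inner_sub_left, inner_smul_left]
  module

/-! ### The first variation at the conformal gradient field. -/

/-- The polynomial `C` with `E'(0) = ∫ w^(p+1) C ⟨σ, ψ⟩` for the conformal gradient field, in terms
of `r = |σ|²` and `l = λ²`. -/
def eulerLagrangePoly (n p q r l : ℝ) : ℝ :=
  (1 + r) * (1 + q * r - n * q * l) - p * l * (n - 2 - q * r)

/-- Linear algebra at one point, with `l` in the role of `λ` and `A`, `A'` in those of the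
differentials of `σ` and `ψ`. The subtracted bracket collects all terms in `A'` and is exactly the
divergence computed in `sum_inner_fderiv_momentum`. -/
theorem ambientDensityDeriv_eq {n : ℕ} (p q : ℝ) {x v v' : EuclideanSpace ℝ (Fin (n + 1))} (l : ℝ)
    {A A' : EuclideanSpace ℝ (Fin (n + 1)) →L[ℝ] EuclideanSpace ℝ (Fin (n + 1))}
    (hx : ‖x‖ = 1) (hv : inner ℝ x v = 0) (hv' : inner ℝ x v' = 0)
    (hA : ∀ u, A u = -(inner ℝ v u) • x - l • (u - inner ℝ x u • x))
    (hA' : ∀ u, inner ℝ x (A' u) = - inner ℝ u v') :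
    1 / 2 * ambientDensityDeriv p q v v' A A' =
      (1 / (1 + ‖v‖ ^ 2)) ^ (p + 1) * eulerLagrangePoly n p q (‖v‖ ^ 2) (l ^ 2) * inner ℝ v v' -
      (((1 / (1 + ‖v‖ ^ 2)) ^ p + 2 * p * l ^ 2 * (1 / (1 + ‖v‖ ^ 2)) ^ (p + 1)) *
        (1 + q * ‖v‖ ^ 2) * inner ℝ v v' + (1 / (1 + ‖v‖ ^ 2)) ^ p * l *
        (∑ j, inner ℝ (A' (EuclideanSpace.basisFun (Fin (n + 1)) ℝ j))
          (EuclideanSpace.basisFun (Fin (n + 1)) ℝ j) + q * inner ℝ (A' v) v -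
          q * (n + 1) * l * inner ℝ v v')) := by
  set b := EuclideanSpace.basisFun (Fin (n + 1)) ℝ
  set δ := ∑ j, inner ℝ (A' (b j)) (b j) with hδ
  have hxx : inner ℝ x x = 1 := by rw [real_inner_self_eq_norm_sq, hx]; norm_num
  have hbb : ∀ j, inner ℝ (b j) (b j) = 1 := fun j => by
    rw [real_inner_self_eq_norm_sq, b.norm_eq_one]; norm_num
  -- In `s1` to `s4`, Parseval evaluates the sums over the basis; of `A'` only its trace `δ` and
  -- `⟨A' v, v⟩` survive.
  have s1 : ∑ j, 2 * inner ℝ (A (b j)) (A' (b j)) = 2 * inner ℝ v v' - 2 * l * δ := by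
    have e : ∀ j, 2 * inner ℝ (A (b j)) (A' (b j)) = 2 * (inner ℝ v (b j) * inner ℝ (b j) v') -
        2 * l * inner ℝ (A' (b j)) (b j) - 2 * l * (inner ℝ x (b j) * inner ℝ (b j) v') := fun j => by
      rw [hA, inner_sub_left, inner_smul_left, inner_smul_left, inner_sub_left, inner_smul_left,
        hA', real_inner_comm (A' (b j)) (b j)]
      simp
      ring
    simp only [e, Finset.sum_sub_distrib, ← Finset.mul_sum, b.sum_inner_mul_inner, hv', ← hδ]
    ring
  have eAv : ∀ u, inner ℝ (A u) v = -l * inner ℝ v u := fun u => by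
    rw [hA, inner_sub_left, inner_smul_left, inner_smul_left, inner_sub_left, inner_smul_left, hv,
      real_inner_comm u v]
    simp
  have eAv' : ∀ u, inner ℝ (A u) v' = -l * inner ℝ u v' := fun u => by
    rw [hA, inner_sub_left, inner_smul_left, inner_smul_left, inner_sub_left, inner_smul_left, hv']
    simp
  have s2 : ∑ j, 2 * inner ℝ (A (b j)) v * (inner ℝ (A (b j)) v' + inner ℝ (A' (b j)) v) =
      2 * l ^ 2 * inner ℝ v v' - 2 * l * inner ℝ (A' v) v := by
    have e : ∀ j, 2 * inner ℝ (A (b j)) v * (inner ℝ (A (b j)) v' + inner ℝ (A' (b j)) v) =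
        2 * l ^ 2 * (inner ℝ v (b j) * inner ℝ (b j) v') -
          2 * l * (inner ℝ v (b j) * inner ℝ (b j) (A'.adjoint v)) := fun j => by
      rw [eAv, eAv', ContinuousLinearMap.adjoint_inner_right]
      ring
    simp only [e, Finset.sum_sub_distrib, ← Finset.mul_sum, b.sum_inner_mul_inner]
    rw [ContinuousLinearMap.adjoint_inner_right]
  have s3 : ∑ j, inner ℝ (A (b j)) v ^ 2 = l ^ 2 * ‖v‖ ^ 2 := by
    have e : ∀ j, inner ℝ (A (b j)) v ^ 2 = l ^ 2 * (inner ℝ v (b j) * inner ℝ (b j) v) := fun j => by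
      rw [eAv, real_inner_comm v (b j)]
      ring
    simp only [e, ← Finset.mul_sum, b.sum_inner_mul_inner, real_inner_self_eq_norm_sq]
  have s4 : ∑ j, ‖A (b j)‖ ^ 2 = ‖v‖ ^ 2 + n * l ^ 2 := by
    have e : ∀ j, ‖A (b j)‖ ^ 2 = inner ℝ v (b j) * inner ℝ (b j) v -
        l ^ 2 * (inner ℝ x (b j) * inner ℝ (b j) x) + l ^ 2 := fun j => by
      rw [← real_inner_self_eq_norm_sq, hA]
      simp only [inner_sub_left, inner_sub_right, inner_smul_left, inner_smul_right, hxx, hbb,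
        real_inner_comm x (b j), real_inner_comm v (b j)]
      simp
      ring
    simp only [e, Finset.sum_add_distrib, Finset.sum_sub_distrib, ← Finset.mul_sum,
      b.sum_inner_mul_inner, hxx, real_inner_self_eq_norm_sq]
    simp
    ring
  have hw : (1 / (1 + ‖v‖ ^ 2)) ^ p = (1 + ‖v‖ ^ 2) * (1 / (1 + ‖v‖ ^ 2)) ^ (p + 1) := by
    rw [Real.rpow_add_one (by positivity)]
    field_simp
  rw [ambientDensityDeriv, s1, s2, s3, s4, hw, eulerLagrangePoly]
  ring

/-- The differential of `y ↦ ⟨a, y⟩ / |y|` at a unit vector. -/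
theorem hasFDerivAt_inner_div_norm {E : Type*} [NormedAddCommGroup E] [InnerProductSpace ℝ E]
    (a : E) {x : E} (hx : ‖x‖ = 1) :
    HasFDerivAt (fun y => ‖y‖⁻¹ * inner ℝ a y) (innerSL ℝ (a - inner ℝ a x • x)) x := by
  have h0 : x ≠ 0 := norm_ne_zero_iff.1 (by simp [hx])
  have h1 : HasFDerivAt (fun y : E => ‖y‖) (innerSL ℝ x) x := by
    have h2 : HasFDerivAt (fun y : E => ‖y‖) (fderiv ℝ (fun y : E => ‖y‖) x) x :=
      ((contDiffAt_norm ℝ h0 (n := 1)).differentiableAt one_ne_zero).hasFDerivAt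
    have h3 := (h2.pow 2).unique (HasStrictFDerivAt.hasFDerivAt (hasStrictFDerivAt_norm_sq x))
    refine h2.congr_fderiv ?_
    ext u
    simpa [hx] using DFunLike.congr_fun h3 u
  have h4 : HasFDerivAt (fun y : E => ‖y‖⁻¹) (-innerSL ℝ x) x := by
    refine ((hasDerivAt_inv (x := ‖x‖) (by simp [hx])).comp_hasFDerivAt x h1).congr_fderiv ?_
    ext u
    simp [hx]
  refine (h4.mul (innerSL ℝ a).hasFDerivAt).congr_fderiv ?_
  ext u
  simp [hx]
  ring

/-- Differentiability being clear, the differential is read off along the lines `x + t u` from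
`hasDerivAt_weight_rpow`. -/
theorem hasFDerivAt_weight_rpow {E : Type*} [NormedAddCommGroup E] [InnerProductSpace ℝ E]
    (p : ℝ) {v : E → E} {x : E} {A : E →L[ℝ] E} (hv : HasFDerivAt v A x) :
    HasFDerivAt (fun y => (1 / (1 + ‖v y‖ ^ 2)) ^ p)
      (-(2 * p * (1 / (1 + ‖v x‖ ^ 2)) ^ (p + 1)) • (innerSL ℝ (v x) ∘L A)) x := by
  have hdiff : DifferentiableAt ℝ (fun y => (1 / (1 + ‖v y‖ ^ 2)) ^ p) x := by
    refine DifferentiableAt.rpow_const ?_ (Or.inl (by positivity))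
    have h1 : DifferentiableAt ℝ (fun y => 1 + ‖v y‖ ^ 2) x :=
      (hv.differentiableAt.norm_sq ℝ).const_add 1
    simp only [one_div]
    exact h1.fun_inv (by positivity)
  refine hdiff.hasFDerivAt.congr_fderiv ?_
  ext u
  have hline : HasDerivAt (fun t : ℝ => x + t • u) u 0 := by
    simpa using ((hasDerivAt_id (0 : ℝ)).smul_const u).const_add x
  have h0 : x = x + (0 : ℝ) • u := by simp
  have hv' : HasDerivAt (fun t : ℝ => v (x + t • u)) (A u) 0 := by
    rw [h0] at hv
    exact HasFDerivAt.comp_hasDerivAt (f := fun t : ℝ => x + t • u) (0 : ℝ) hv hline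
  have h1 := hasDerivAt_weight_rpow p hv'
  have h3 : HasFDerivAt (fun y => (1 / (1 + ‖v y‖ ^ 2)) ^ p)
      (fderiv ℝ (fun y => (1 / (1 + ‖v y‖ ^ 2)) ^ p) x) (x + (0 : ℝ) • u) := by
    rw [← h0]
    exact hdiff.hasFDerivAt
  have h4 := (HasFDerivAt.comp_hasDerivAt (f := fun t : ℝ => x + t • u) (0 : ℝ) h3 hline).unique h1
  rw [h4]
  simp
  ring

/-- The tangential field whose divergence is the difference between the first variation of the
energy density and its Euler–Lagrange form. -/
def momentum {n : ℕ} (p q : ℝ) (a : EuclideanSpace ℝ (Fin (n + 1)))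
    (v w : EuclideanSpace ℝ (Fin (n + 1)) → EuclideanSpace ℝ (Fin (n + 1)))
    (y : EuclideanSpace ℝ (Fin (n + 1))) : EuclideanSpace ℝ (Fin (n + 1)) :=
  ((1 / (1 + ‖v y‖ ^ 2)) ^ p * (‖y‖⁻¹ * inner ℝ a y)) • (w y + (q * inner ℝ (w y) (v y)) • v y)

/-- Product rule with `∇λ = σ`, `∇(w^p) = 2pλ w^(p+1) σ` and `div σ = -nλ`. The factor `n + 1` adds
to this `n` one further `-λ` from `⟨ψ, ∇_σ σ⟩`. -/
theorem sum_inner_fderiv_momentum {n : ℕ} (p q : ℝ) {a x : EuclideanSpace ℝ (Fin (n + 1))}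
    {v w : EuclideanSpace ℝ (Fin (n + 1)) → EuclideanSpace ℝ (Fin (n + 1))}
    {A B : EuclideanSpace ℝ (Fin (n + 1)) →L[ℝ] EuclideanSpace ℝ (Fin (n + 1))}
    (hx : ‖x‖ = 1) (hv : HasFDerivAt v A x) (hw : HasFDerivAt w B x)
    (hvx : v x = a - inner ℝ a x • x) (hwx : inner ℝ x (w x) = 0)
    (hA : ∀ u, A u = -(inner ℝ (v x) u) • x - inner ℝ a x • (u - inner ℝ x u • x)) :
    ∑ j, inner ℝ (fderiv ℝ (momentum p q a v w) x (EuclideanSpace.basisFun (Fin (n + 1)) ℝ j))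
        (EuclideanSpace.basisFun (Fin (n + 1)) ℝ j) =
      ((1 / (1 + ‖v x‖ ^ 2)) ^ p + 2 * p * inner ℝ a x ^ 2 * (1 / (1 + ‖v x‖ ^ 2)) ^ (p + 1)) *
        (1 + q * ‖v x‖ ^ 2) * inner ℝ (v x) (w x) + (1 / (1 + ‖v x‖ ^ 2)) ^ p * inner ℝ a x *
        (∑ j, inner ℝ (B (EuclideanSpace.basisFun (Fin (n + 1)) ℝ j))
          (EuclideanSpace.basisFun (Fin (n + 1)) ℝ j) + q * inner ℝ (B (v x)) (v x) -
          q * (n + 1) * inner ℝ a x * inner ℝ (v x) (w x)) := by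
  set b := EuclideanSpace.basisFun (Fin (n + 1)) ℝ
  set l := inner ℝ a x with hl
  set W := (1 / (1 + ‖v x‖ ^ 2)) ^ p with hW
  set W' := (1 / (1 + ‖v x‖ ^ 2)) ^ (p + 1) with hW'
  have hxx : inner ℝ x x = 1 := by rw [real_inner_self_eq_norm_sq, hx]; norm_num
  have hvx0 : inner ℝ x (v x) = 0 := by
    rw [hvx, inner_sub_right, inner_smul_right, hxx, real_inner_comm]
    ring
  have eAv : ∀ u, inner ℝ (v x) (A u) = -l * inner ℝ (v x) u := fun u => by
    rw [hA, inner_sub_right, inner_smul_right, inner_smul_right, inner_sub_right,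
      inner_smul_right, real_inner_comm x, hvx0]
    ring
  have eAw : ∀ u, inner ℝ (w x) (A u) = -l * inner ℝ (w x) u := fun u => by
    rw [hA, inner_sub_right, inner_smul_right, inner_smul_right, inner_sub_right,
      inner_smul_right, real_inner_comm x, hwx]
    ring
  have hl' := hasFDerivAt_inner_div_norm a hx
  rw [← hl, ← hvx] at hl'
  have hcoef := (hasFDerivAt_weight_rpow p hv).mul hl'
  have hfield := hw.add (((hw.inner ℝ hv).const_mul q).smul hv)
  have hder : ∀ u, fderiv ℝ (momentum p q a v w) x u =
      ((W + 2 * p * l ^ 2 * W') * inner ℝ (v x) u) • (w x + (q * inner ℝ (w x) (v x)) • v x) +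
      (W * l) • (B u + (q * inner ℝ (w x) (v x)) • A u +
        (q * (inner ℝ (B u) (v x) - l * inner ℝ (w x) u)) • v x) := fun u => by
    refine (DFunLike.congr_fun (hcoef.smul hfield).fderiv u).trans ?_
    simp only [add_apply, smul_apply, Pi.mul_apply, Pi.add_apply, Pi.smul_apply', inv_one, one_mul,
      ContinuousLinearMap.smulRight_apply, ContinuousLinearMap.comp_apply,
      ContinuousLinearMap.prod_apply, fderivInnerCLM_apply, innerSL_apply_apply, smul_eq_mul,
      eAv, eAw, hx, ← hW, ← hW', ← hl]
    simp
    module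
  have hbb : ∀ j, inner ℝ (b j) (b j) = 1 := fun j => by
    rw [real_inner_self_eq_norm_sq, b.norm_eq_one]; norm_num
  have e : ∀ j, inner ℝ (fderiv ℝ (momentum p q a v w) x (b j)) (b j) =
      (W + 2 * p * l ^ 2 * W') * (inner ℝ (v x) (b j) * inner ℝ (b j) (w x)) +
      (W + 2 * p * l ^ 2 * W') * (q * inner ℝ (w x) (v x)) *
        (inner ℝ (v x) (b j) * inner ℝ (b j) (v x)) +
      W * l * inner ℝ (B (b j)) (b j) +
      W * l * (q * inner ℝ (w x) (v x)) * (-(inner ℝ (v x) (b j) * inner ℝ (b j) x)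
        - l * (1 - inner ℝ x (b j) * inner ℝ (b j) x)) +
      W * l * q * (inner ℝ (v x) (b j) * inner ℝ (b j) (B.adjoint (v x))) -
      W * l * q * l * (inner ℝ (w x) (b j) * inner ℝ (b j) (v x)) := fun j => by
    rw [hder, hA, ContinuousLinearMap.adjoint_inner_right]
    simp only [inner_add_left, inner_sub_left, inner_smul_left, hbb, real_inner_comm x (b j),
      real_inner_comm (w x) (b j), real_inner_comm (v x) (b j)]
    simp
    ring
  simp only [e, Finset.sum_add_distrib, Finset.sum_sub_distrib, ← Finset.mul_sum,
    Finset.sum_neg_distrib, b.sum_inner_mul_inner, hxx]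
  rw [ContinuousLinearMap.adjoint_inner_right, real_inner_comm x (v x), hvx0,
    real_inner_comm (v x) (w x), real_inner_self_eq_norm_sq]
  simp
  ring

section FirstVariation

variable {n : ℕ} {a : EuclideanSpace ℝ (Fin (n + 1))}

theorem contDiffAt_ambient_conformalGradientField {y : EuclideanSpace ℝ (Fin (n + 1))}
    (hy : y ≠ 0) {m : ℕ∞ω} : ContDiffAt ℝ m (ambient (conformalGradientField n a)) y := by
  have h1 : ambient (conformalGradientField n a) =ᶠ[nhds y]
      fun y => a - ((‖y‖ ^ 2)⁻¹ * inner ℝ a y) • y := by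
    filter_upwards [isOpen_compl_singleton.mem_nhds hy] with y hy
    exact ambient_conformalGradientField a hy
  refine ContDiffAt.congr_of_eventuallyEq ?_ h1
  have h2 : ContDiffAt ℝ m (fun y : EuclideanSpace ℝ (Fin (n + 1)) => (‖y‖ ^ 2)⁻¹) y :=
    (contDiffAt_id.norm_sq ℝ).inv (by simpa using hy)
  exact contDiffAt_const.sub ((h2.mul (contDiffAt_const.inner ℝ contDiffAt_id)).smul contDiffAt_id)

theorem contDiffAt_momentum (p q : ℝ)
    {v w : EuclideanSpace ℝ (Fin (n + 1)) → EuclideanSpace ℝ (Fin (n + 1))}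
    {y : EuclideanSpace ℝ (Fin (n + 1))} (hy : y ≠ 0) {m : ℕ∞ω}
    (hv : ContDiffAt ℝ m v y) (hw : ContDiffAt ℝ m w y) :
    ContDiffAt ℝ m (momentum p q a v w) y := by
  have h1 : ContDiffAt ℝ m (fun y => (1 / (1 + ‖v y‖ ^ 2)) ^ p) y := by
    refine ContDiffAt.rpow_const_of_ne ?_ (by positivity)
    exact contDiffAt_const.div (contDiffAt_const.add (hv.norm_sq ℝ)) (by positivity)
  have h2 : ContDiffAt ℝ m (fun y => ‖y‖⁻¹ * inner ℝ a y) y :=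
    ((contDiffAt_norm ℝ hy).inv (norm_ne_zero_iff.2 hy)).mul
      (contDiffAt_const.inner ℝ contDiffAt_id)
  exact (h1.mul h2).smul (hw.add ((contDiffAt_const.mul (hw.inner ℝ hv)).smul hv))

theorem continuous_weight_mul_eulerLagrangePoly {X : Type*} [TopologicalSpace X] {E : Type*}
    [NormedAddCommGroup E] [InnerProductSpace ℝ E] (k m p q : ℝ) {v w : X → E} {l : X → ℝ}
    (hv : Continuous v) (hl : Continuous l) (hw : Continuous w) :
    Continuous fun x => (1 / (1 + ‖v x‖ ^ 2)) ^ k *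
      eulerLagrangePoly m p q (‖v x‖ ^ 2) (l x ^ 2) * inner ℝ (v x) (w x) := by
  have h1 : Continuous fun x => (1 / (1 + ‖v x‖ ^ 2)) ^ k := by
    have h2 : Continuous fun x => 1 / (1 + ‖v x‖ ^ 2) :=
      continuous_const.div (by fun_prop) (fun x => by positivity)
    exact h2.rpow_const fun x => Or.inl (by positivity)
  have h3 : Continuous fun x => eulerLagrangePoly m p q (‖v x‖ ^ 2) (l x ^ 2) := by
    unfold eulerLagrangePoly
    fun_prop
  exact (h1.mul h3).mul (hv.inner hw)

theorem contDiff_eulerLagrangePoly {E : Type*} [NormedAddCommGroup E] [NormedSpace ℝ E]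
    (k p q : ℝ) {r l : E → ℝ} {m : ℕ∞ω} (hr : ContDiff ℝ m r) (hl : ContDiff ℝ m l) :
    ContDiff ℝ m fun y => eulerLagrangePoly k p q (r y) (l y) := by
  unfold eulerLagrangePoly
  fun_prop

/-- The first variation formula for the vertical energy at a conformal gradient field. -/
theorem hasDerivAt_vertEnergy_conformalGradientField (p q : ℝ)
    {s : ℝ → Π x : Sph n, TangentSpace (𝓡 n) x}
    (hs : IsSmoothVariation (𝓡 n) (EuclideanSpace ℝ (Fin n)) (conformalGradientField n a) s) :
    HasDerivAt (fun t => vertEnergy (sphereVol n) (leviCivita n) p q (s t))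
      (∫ x : Sph n, (1 / (1 + ‖conformalGradientField n a x‖ ^ 2)) ^ (p + 1) *
        eulerLagrangePoly n p q (‖conformalGradientField n a x‖ ^ 2)
          (inner ℝ a (x : EuclideanSpace ℝ (Fin (n + 1))) ^ 2) *
        inner ℝ (incl n x (conformalGradientField n a x)) (variationField s x) ∂sphereVol n) 0 := by
  set V := ambient (conformalGradientField n a) with hVdef
  set ψ := variationField s with hψ
  have hV : ∀ y ≠ 0, ContDiffAt ℝ 1 V y := fun y hy => contDiffAt_ambient_conformalGradientField hy
  have hψc : ∀ y ≠ 0, ContDiffAt ℝ 1 ψ y := fun y hy =>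
    (contDiffAt_variationField hs hy).of_le (by simp)
  have hY : ∀ y ≠ 0, ContDiffAt ℝ 1 (momentum p q a V ψ) y := fun y hy =>
    contDiffAt_momentum p q hy (hV y hy) (hψc y hy)
  have hVx : ∀ x : Sph n, V x = a - inner ℝ a (x : EuclideanSpace ℝ (Fin (n + 1))) •
      (x : EuclideanSpace ℝ (Fin (n + 1))) := fun x => by
    rw [hVdef, ambient_coe, incl_conformalGradientField]
  have hdiv : ∫ x : Sph n, ∑ j, inner ℝ (fderiv ℝ (momentum p q a V ψ) x
      (EuclideanSpace.basisFun (Fin (n + 1)) ℝ j)) (EuclideanSpace.basisFun (Fin (n + 1)) ℝ j)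
        ∂sphereVol n = 0 := by
    refine integral_toSphere_div _ (fun y hy => (hY y hy).contDiffWithinAt) ?_ ?_ _
    · intro y hy r hr
      have h1 : ‖r • y‖⁻¹ * inner ℝ a (r • y) = ‖y‖⁻¹ * inner ℝ a y := by
        rw [norm_smul, inner_smul_right, Real.norm_of_nonneg hr.le]
        field_simp
      simp only [momentum, h1, hVdef, hψ, ambient_smul _ hy hr, variationField_smul hy hr]
    · intro y hy
      rw [momentum, inner_smul_left, inner_add_left, inner_smul_left, real_inner_comm y (ψ y),
        real_inner_comm y (V y), inner_variationField hs hy, inner_self_ambient _ hy]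
      simp
  have hcoe : Continuous fun x : Sph n => (x : EuclideanSpace ℝ (Fin (n + 1))) :=
    continuous_subtype_val
  have hcomp : ∀ {F : Type} [TopologicalSpace F] {f : EuclideanSpace ℝ (Fin (n + 1)) → F},
      (∀ y ≠ 0, ContinuousAt f y) → Continuous fun x : Sph n => f x := fun hf =>
    continuous_iff_continuousAt.2 fun x =>
      ContinuousAt.comp (f := fun x : Sph n => (x : EuclideanSpace ℝ (Fin (n + 1))))
        (hf _ (sph_ne_zero x)) hcoe.continuousAt
  have hdivc : Continuous fun x : Sph n => ∑ j, inner ℝ (fderiv ℝ (momentum p q a V ψ) x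
      (EuclideanSpace.basisFun (Fin (n + 1)) ℝ j)) (EuclideanSpace.basisFun (Fin (n + 1)) ℝ j) := by
    have h1 : Continuous fun x : Sph n => fderiv ℝ (momentum p q a V ψ) x :=
      hcomp fun y hy => ((hY y hy).fderiv_right (m := 0) (by simp)).continuousAt
    exact continuous_finsetSum _ fun j _ => (h1.clm_apply continuous_const).inner continuous_const
  have hVc : Continuous fun x : Sph n => V x := hcomp fun y hy => (hV y hy).continuousAt
  have hψcont : Continuous fun x : Sph n => ψ x := hcomp fun y hy => (hψc y hy).continuousAt
  have hFc : Continuous fun x : Sph n => (1 / (1 + ‖V x‖ ^ 2)) ^ (p + 1) *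
      eulerLagrangePoly n p q (‖V x‖ ^ 2) (inner ℝ a (x : EuclideanSpace ℝ (Fin (n + 1))) ^ 2) *
        inner ℝ (V x) (ψ x) :=
    continuous_weight_mul_eulerLagrangePoly _ _ _ _ hVc (by fun_prop) hψcont
  have hint : ∀ {f : Sph n → ℝ}, Continuous f → Integrable f (sphereVol n) := fun hf =>
    hf.integrable_of_hasCompactSupport (HasCompactSupport.of_compactSpace _)
  refine (hasDerivAt_vertEnergy p q hs).congr_deriv ?_
  rw [← integral_const_mul]
  -- Pointwise, the first variation density is its Euler–Lagrange form minus a divergence, which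
  -- `hdiv` integrates to zero.
  have hpt : ∀ x : Sph n, 1 / 2 * ambientDensityDeriv p q (V x) (ψ x)
      (fderiv ℝ V x) (fderiv ℝ ψ x) =
      (1 / (1 + ‖V x‖ ^ 2)) ^ (p + 1) *
      eulerLagrangePoly n p q (‖V x‖ ^ 2) (inner ℝ a (x : EuclideanSpace ℝ (Fin (n + 1))) ^ 2) *
        inner ℝ (V x) (ψ x) - ∑ j, inner ℝ (fderiv ℝ (momentum p q a V ψ) x
      (EuclideanSpace.basisFun (Fin (n + 1)) ℝ j)) (EuclideanSpace.basisFun (Fin (n + 1)) ℝ j) := by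
    intro x
    have hx := sph_ne_zero x
    have hψd : DifferentiableAt ℝ ψ x := (hψc _ hx).differentiableAt one_ne_zero
    rw [sum_inner_fderiv_momentum p q (sph_norm x)
      ((hV _ hx).differentiableAt one_ne_zero).hasFDerivAt hψd.hasFDerivAt (hVx x)
      (inner_variationField hs hx) (fderiv_ambient_conformalGradientField a x)]
    refine ambientDensityDeriv_eq p q _ (sph_norm x) (inner_self_ambient _ hx)
      (inner_variationField hs hx) (fderiv_ambient_conformalGradientField a x) ?_
    refine inner_fderiv_of_tangent hψd ?_
    filter_upwards [isOpen_compl_singleton.mem_nhds hx] with y hy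
    exact inner_variationField hs hy
  refine (integral_congr_ae (.of_forall hpt)).trans ?_
  rw [integral_sub (hint hFc) (hint hdivc), hdiv, sub_zero]
  refine integral_congr_ae (.of_forall fun x => ?_)
  have e : V x = incl n x (conformalGradientField n a x) := ambient_coe _ x
  dsimp only
  rw [e, norm_incl]

/-! ### Harmonicity as the vanishing of the Euler–Lagrange polynomial. -/

/-- Rescaling the conformal gradient field by a function. -/
def rescaled (n : ℕ) (a : EuclideanSpace ℝ (Fin (n + 1)))
    (g : EuclideanSpace ℝ (Fin (n + 1)) → ℝ) (t : ℝ) (x : Sph n) : TangentSpace (𝓡 n) x :=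
  proj n x ((1 + t * g x) • (a - inner ℝ a (x : EuclideanSpace ℝ (Fin (n + 1))) •
    (x : EuclideanSpace ℝ (Fin (n + 1)))))

theorem inner_sub_inner_smul (x : Sph n) :
    inner ℝ (x : EuclideanSpace ℝ (Fin (n + 1))) (a -
      inner ℝ a (x : EuclideanSpace ℝ (Fin (n + 1))) • (x : EuclideanSpace ℝ (Fin (n + 1)))) = 0 := by
  rw [← incl_conformalGradientField, inner_incl]

theorem isSmoothVariation_rescaled {g : EuclideanSpace ℝ (Fin (n + 1)) → ℝ}
    (hg : ContDiff ℝ ∞ g) : IsSmoothVariation (𝓡 n) (EuclideanSpace ℝ (Fin n))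
      (conformalGradientField n a) (rescaled n a g) := by
  constructor
  · refine contMDiff_mk_proj (I' := (𝓡 n).prod 𝓘(ℝ, ℝ)) (M' := Sph n × ℝ) (f := Prod.fst)
      (w := fun z => (1 + z.2 * g z.1) • (a - inner ℝ a (z.1 : EuclideanSpace ℝ (Fin (n + 1))) •
        (z.1 : EuclideanSpace ℝ (Fin (n + 1))))) contMDiff_fst ?_ ?_
    · have h1 : ContDiff ℝ ∞ fun z : EuclideanSpace ℝ (Fin (n + 1)) × ℝ =>
          (1 + z.2 * g z.1) • (a - inner ℝ a z.1 • z.1) :=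
        (contDiff_const.add (contDiff_snd.mul (hg.comp contDiff_fst))).smul
          (contDiff_const.sub ((contDiff_const.inner ℝ contDiff_fst).smul contDiff_fst))
      have h2 : ContMDiff ((𝓡 n).prod 𝓘(ℝ, ℝ)) 𝓘(ℝ, EuclideanSpace ℝ (Fin (n + 1)) × ℝ) ∞
          fun z : Sph n × ℝ => ((z.1 : EuclideanSpace ℝ (Fin (n + 1))), z.2) :=
        (contMDiff_coe_sphere.comp contMDiff_fst).prodMk_space contMDiff_snd
      exact h1.contMDiff.comp h2
    · intro z
      rw [inner_smul_right, inner_sub_inner_smul, mul_zero]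
  · ext1 x
    rw [rescaled, zero_mul, add_zero, one_smul, ← incl_conformalGradientField, proj_incl]

theorem variationField_rescaled (g : EuclideanSpace ℝ (Fin (n + 1)) → ℝ) (x : Sph n) :
    variationField (rescaled n a g) x = g x • incl n x (conformalGradientField n a x) := by
  have h1 : ∀ t, ambient (rescaled n a g t) x =
      (1 + t * g x) • incl n x (conformalGradientField n a x) := fun t => by
    rw [ambient_coe, rescaled, incl_proj, inner_smul_right, inner_sub_inner_smul,
      incl_conformalGradientField]
    simp
  simp only [variationField, h1]
  have h2 : HasDerivAt (fun t : ℝ => 1 + t * g x) (g x) 0 := by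
    simpa using ((hasDerivAt_id (0 : ℝ)).mul_const (g x)).const_add 1
  exact (h2.smul_const _).deriv

/-- The test variation rescales `σ` by the polynomial itself, making the first variation the
integral of a continuous nonnegative function `w^(p+1) C² |σ|²`. At zeros of `σ` this gives no
information, whence `hx`. -/
theorem eulerLagrangePoly_eq_zero_of_harmonic {p q : ℝ}
    (h : IsPQHarmonic (sphereVol n) (leviCivita n) p q (conformalGradientField n a)) (x : Sph n)
    (hx : conformalGradientField n a x ≠ 0) :
    eulerLagrangePoly n p q (‖conformalGradientField n a x‖ ^ 2)
      (inner ℝ a (x : EuclideanSpace ℝ (Fin (n + 1))) ^ 2) = 0 := by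
  -- Substituting `|σ|² = |a|² - λ²` makes the test function a polynomial on the whole ambient
  -- space, hence smooth.
  let g : EuclideanSpace ℝ (Fin (n + 1)) → ℝ := fun y =>
    eulerLagrangePoly n p q (‖a‖ ^ 2 - inner ℝ a y ^ 2) (inner ℝ a y ^ 2)
  have hg : ContDiff ℝ ∞ g := by
    have hl : ContDiff ℝ ∞ fun y : EuclideanSpace ℝ (Fin (n + 1)) => inner ℝ a y ^ 2 :=
      (contDiff_const.inner ℝ contDiff_id).pow 2
    exact contDiff_eulerLagrangePoly _ _ _ (contDiff_const.sub hl) hl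
  have hgx : ∀ x : Sph n, eulerLagrangePoly n p q (‖conformalGradientField n a x‖ ^ 2)
      (inner ℝ a (x : EuclideanSpace ℝ (Fin (n + 1))) ^ 2) = g x := fun x => by
    rw [norm_sq_conformalGradientField]
  have hs := isSmoothVariation_rescaled (a := a) hg
  have h0 := (hasDerivAt_vertEnergy_conformalGradientField p q hs).unique (h.2 _ hs)
  simp only [variationField_rescaled, inner_smul_right, real_inner_self_eq_norm_sq,
    norm_incl, norm_sq_conformalGradientField] at h0
  rw [hgx]
  by_contra hne
  have hcoe : Continuous fun x : Sph n => (x : EuclideanSpace ℝ (Fin (n + 1))) :=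
    continuous_subtype_val
  have hr : ∀ x : Sph n, 0 ≤ ‖a‖ ^ 2 - inner ℝ a (x : EuclideanSpace ℝ (Fin (n + 1))) ^ 2 :=
    fun x => by rw [← norm_sq_conformalGradientField]; positivity
  have hposw : ∀ x : Sph n,
      0 < 1 + (‖a‖ ^ 2 - inner ℝ a (x : EuclideanSpace ℝ (Fin (n + 1))) ^ 2) :=
    fun x => by linarith [hr x]
  have hcont : Continuous fun x : Sph n =>
      (1 / (1 + (‖a‖ ^ 2 - inner ℝ a (x : EuclideanSpace ℝ (Fin (n + 1))) ^ 2))) ^ (p + 1) * g x *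
      (g x * (‖a‖ ^ 2 - inner ℝ a (x : EuclideanSpace ℝ (Fin (n + 1))) ^ 2)) := by
    have h1 : Continuous fun x : Sph n =>
        (1 / (1 + (‖a‖ ^ 2 - inner ℝ a (x : EuclideanSpace ℝ (Fin (n + 1))) ^ 2))) ^ (p + 1) := by
      have h2 : Continuous fun x : Sph n =>
          1 / (1 + (‖a‖ ^ 2 - inner ℝ a (x : EuclideanSpace ℝ (Fin (n + 1))) ^ 2)) :=
        continuous_const.div (by fun_prop) (fun x => (hposw x).ne')
      exact h2.rpow_const fun x => Or.inl (one_div_pos.2 (hposw x)).ne'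
    have h3 : Continuous fun x : Sph n => g x := hg.continuous.comp hcoe
    fun_prop
  refine (hcont.integral_pos_of_hasCompactSupport_nonneg_nonzero
    (HasCompactSupport.of_compactSpace _) (fun y => ?_) (x := x) ?_ (μ := sphereVol n)).ne' h0
  · have h1 := Real.rpow_nonneg (one_div_pos.2 (hposw y)).le (p + 1)
    have h2 := mul_nonneg (mul_nonneg h1 (mul_self_nonneg (g y))) (hr y)
    simp only [Pi.zero_apply]
    linarith
  · have h1 := (Real.rpow_pos_of_pos (one_div_pos.2 (hposw x)) (p + 1)).ne'
    refine mul_ne_zero (mul_ne_zero h1 hne) (mul_ne_zero hne ?_)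
    rw [← norm_sq_conformalGradientField]
    simpa using hx

theorem isPQHarmonic_of_eulerLagrangePoly_eq_zero {p q : ℝ}
    (h : ∀ x : Sph n, eulerLagrangePoly n p q (‖conformalGradientField n a x‖ ^ 2)
      (inner ℝ a (x : EuclideanSpace ℝ (Fin (n + 1))) ^ 2) = 0) :
    IsPQHarmonic (sphereVol n) (leviCivita n) p q (conformalGradientField n a) := by
  refine ⟨isSmoothSection_conformalGradientField a, fun s hs => ?_⟩
  refine (hasDerivAt_vertEnergy_conformalGradientField p q hs).congr_deriv ?_
  simp [h]

end FirstVariation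

/-! ### Solving for the parameters. -/

/-- Take `c a/|a| + √(1 - c²) b` with `b` a unit vector orthogonal to `a`, which exists because `n ≥
1`. -/
theorem exists_sph_inner_eq {n : ℕ} (hn : 1 ≤ n) {a : EuclideanSpace ℝ (Fin (n + 1))} (ha : a ≠ 0)
    {c : ℝ} (hc : c ^ 2 ≤ 1) :
    ∃ x : Sph n, inner ℝ a (x : EuclideanSpace ℝ (Fin (n + 1))) = c * ‖a‖ := by
  have hfr := Submodule.finrank_orthogonal_span_singleton (𝕜 := ℝ) (n := n) ha
  have : Nontrivial (ℝ ∙ a)ᗮ := Module.nontrivial_of_finrank_pos (R := ℝ) (by omega)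
  obtain ⟨b, hb⟩ := exists_norm_eq (ℝ ∙ a)ᗮ (zero_le_one (α := ℝ))
  have hab : inner ℝ a (b : EuclideanSpace ℝ (Fin (n + 1))) = 0 :=
    Submodule.mem_orthogonal_singleton_iff_inner_right.1 b.2
  have hna := norm_ne_zero_iff.2 ha
  have hb' : ‖(b : EuclideanSpace ℝ (Fin (n + 1)))‖ = 1 := hb
  refine ⟨⟨(c * ‖a‖⁻¹) • a + √(1 - c ^ 2) • (b : EuclideanSpace ℝ (Fin (n + 1))), ?_⟩, ?_⟩
  · rw [mem_sphere_zero_iff_norm, ← sq_eq_sq₀ (norm_nonneg _) zero_le_one, norm_add_sq_real,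
      norm_smul, norm_smul, mul_pow, mul_pow, inner_smul_left, inner_smul_right, hab, hb',
      Real.norm_eq_abs, Real.norm_eq_abs, sq_abs, sq_abs, Real.sq_sqrt (by linarith)]
    field_simp
    ring
  · simp only [inner_add_right, inner_smul_right, hab, real_inner_self_eq_norm_sq]
    field_simp
    ring

theorem iSup_norm_conformalGradientField {n : ℕ} (hn : 1 ≤ n)
    {a : EuclideanSpace ℝ (Fin (n + 1))} (ha : a ≠ 0) :
    ⨆ x : Sph n, ‖conformalGradientField n a x‖ = ‖a‖ := by
  obtain ⟨x, hx⟩ := exists_sph_inner_eq hn ha (c := 0) (by norm_num)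
  have hle : ∀ x : Sph n, ‖conformalGradientField n a x‖ ≤ ‖a‖ := fun x => by
    rw [← sq_le_sq₀ (norm_nonneg _) (norm_nonneg _), norm_sq_conformalGradientField]
    linarith [sq_nonneg (inner ℝ a (x : EuclideanSpace ℝ (Fin (n + 1))))]
  have : Nonempty (Sph n) := ⟨x⟩
  refine le_antisymm (ciSup_le hle) ?_
  refine le_trans ?_ (le_ciSup ⟨‖a‖, by rintro _ ⟨x, rfl⟩; exact hle x⟩ x)
  rw [← sq_le_sq₀ (norm_nonneg _) (norm_nonneg _), norm_sq_conformalGradientField, hx]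
  simp

/-- Here `A = |a|²` and `λ = c|a|`. At `c = 0` the polynomial is `(1 + A)(1 + qA)`. Once `qA = -1`,
it equals `c²` times `(1 + A(1 - c²))(n + 1) - pA(n - 1 - c²)`, which is affine in `c²`, so two
further values of `c` suffice. -/
theorem parameters_of_eulerLagrangePoly_eq_zero {n : ℕ} {p q A : ℝ} (hA : 0 < A)
    (h : ∀ c : ℝ, c ^ 2 < 1 → eulerLagrangePoly n p q (A * (1 - c ^ 2)) (A * c ^ 2) = 0) :
    3 ≤ n ∧ p = n + 1 ∧ q = 2 - n ∧ A * (n - 2) = 1 := by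
  have e0 := h 0 (by norm_num)
  have e1 := h (1 / 2) (by norm_num)
  have e2 := h (3 / 4) (by norm_num)
  simp only [eulerLagrangePoly] at e0 e1 e2
  have hq : q * A = -1 := by
    have h1 : (1 + A) * (1 + q * A) = 0 := by linear_combination e0
    have h2 := (mul_eq_zero.1 h1).resolve_left (by positivity)
    linarith
  -- `f1` and `f2` are the bracket at `c² = 1/4` and `c² = 9/16`; their difference isolates `p`.
  have f1 : (1 + 3 / 4 * A) * (1 + n) - p * A * (n - 5 / 4) = 0 := by
    linear_combination 4 * e1 - (4 * (1 + 3 / 4 * A) * (3 / 4 - n / 4) + 3 / 4 * p * A) * hq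
  have f2 : (1 + 7 / 16 * A) * (1 + n) - p * A * (n - 25 / 16) = 0 := by
    linear_combination 16 / 9 * e2 -
      (16 / 9 * (1 + 7 / 16 * A) * (7 / 16 - n * 9 / 16) + 7 / 16 * p * A) * hq
  have hp : p = n + 1 := by
    have h1 : A * (p - (n + 1)) = 0 := by linear_combination 16 / 5 * (f2 - f1)
    have h2 := (mul_eq_zero.1 h1).resolve_left hA.ne'
    linarith
  have hAn : A * (n - 2) = 1 := by
    have h1 : ((n : ℝ) + 1) * (1 - A * (n - 2)) = 0 := by
      rw [hp] at f1
      linear_combination f1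
    have h2 := (mul_eq_zero.1 h1).resolve_left (by positivity)
    linarith
  refine ⟨?_, hp, ?_, hAn⟩
  · have h1 : (2 : ℝ) < n := by
      by_contra hle
      have := mul_nonneg hA.le (sub_nonneg.2 (not_lt.1 hle))
      linarith
    exact_mod_cast h1
  · have h1 : A * (q - (2 - n)) = 0 := by linear_combination hq + hAn
    have h2 := (mul_eq_zero.1 h1).resolve_left hA.ne'
    linarith

end PQHarmonic

end

/-! ### The characterization. -/

theorem theorem5p2 (n : ℕ) (hn : 1 ≤ n) (a : EuclideanSpace ℝ (Fin (n + 1))) (ha : a ≠ 0)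
    (p q : ℝ) :
    PQHarmonic.IsPQHarmonic (PQHarmonic.sphereVol n) (PQHarmonic.leviCivita n) p q
        (PQHarmonic.conformalGradientField n a) ↔
      3 ≤ n ∧ p = n + 1 ∧ q = 2 - n ∧
        ⨆ x : PQHarmonic.Sph n, ‖PQHarmonic.conformalGradientField n a x‖ = 1 / √(n - 2) := by
  have hna : 0 < ‖a‖ := norm_pos_iff.2 ha
  rw [PQHarmonic.iSup_norm_conformalGradientField hn ha]
  constructor
  · intro h
    obtain ⟨h3, hp, hq, hA⟩ := PQHarmonic.parameters_of_eulerLagrangePoly_eq_zero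
      (n := n) (p := p) (q := q) (A := ‖a‖ ^ 2) (by positivity) (fun c hc => by
        obtain ⟨x, hx⟩ := PQHarmonic.exists_sph_inner_eq hn ha hc.le
        have hr := PQHarmonic.norm_sq_conformalGradientField a x
        -- The strict bound `c² < 1` keeps `x` away from the zeros `±a/|a|` of the field.
        have h1 := PQHarmonic.eulerLagrangePoly_eq_zero_of_harmonic h x (fun h0 => by
          rw [h0, norm_zero, hx] at hr
          have : 0 < ‖a‖ ^ 2 * (1 - c ^ 2) := mul_pos (by positivity) (by linarith)
          linarith)
        rw [hr, hx] at h1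
        convert! h1 using 2 <;> ring)
    refine ⟨h3, hp, hq, ?_⟩
    have hpos : (0 : ℝ) < n - 2 := by
      have : (3 : ℝ) ≤ n := by exact_mod_cast h3
      linarith
    rw [← Real.sqrt_sq hna.le, ← Real.sqrt_one, ← Real.sqrt_div zero_le_one]
    congr 1
    rw [eq_div_iff hpos.ne', hA]
  · rintro ⟨h3, rfl, rfl, hsup⟩
    have hpos : (0 : ℝ) < n - 2 := by
      have : (3 : ℝ) ≤ n := by exact_mod_cast h3
      linarith
    refine PQHarmonic.isPQHarmonic_of_eulerLagrangePoly_eq_zero fun x => ?_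
    have hA : ‖a‖ ^ 2 * (n - 2) = 1 := by
      rw [hsup, div_pow, Real.sq_sqrt hpos.le]
      field_simp
    rw [PQHarmonic.norm_sq_conformalGradientField, PQHarmonic.eulerLagrangePoly]
    -- For these `p` and `q` the polynomial factors as `(1 + r)(1 - (n - 2)(r + l))`, and `r + l =
    -- |a|²`.
    linear_combination
      (-(1 + (‖a‖ ^ 2 - inner ℝ a (x : EuclideanSpace ℝ (Fin (n + 1))) ^ 2))) * hA
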